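/- Let $n\ge 1$, $\sigma>0$, $\mu\in\mathbb R^n$, $\varepsilon\sim N(0,\sigma^2 I_n)$ and $y=\mu+\varepsilon$. Let $\hat\mu:\mathbb R^n\to\mathbb R^n$ be $1$-Lipschitz for the Euclidean norm, write $\hat\mu=\hat\mu(y)$, and suppose that the gradient matrix $\nabla\hat\mu(y)$ (with entries $(\nabla\hat\mu)_{ji}=\partial\hat\mu_i/\partial y_j$) is almost surely symmetric positive semi-definite. Put $$\hat{\mathsf{df}}=\operatorname{div}\hat\mu(y)=\operatorname{trace}\nabla\hat\mu(y),\qquad \mathrm{SURE}=\|y-\hat\mu\|^2+2\sigma^2\,\hat{\mathsf{df}}-\sigma^2 n,\qquad \hat\gamma_n=4\Big\{\frac{\mathrm{SURE}}{n\sigma^2}+\frac{\operatorname{trace}\nabla\hat\mu(y)}{n}\Big\}_+ .$$ Then $\|\mu-\hat\mu\|^2$, $\mathrm{SURE}$ and $\hat{\mathsf{df}}$ are integrable, $\mathrm{SURE}-\mathbb E\|\mu-\hat\mu\|^2+(n\sigma^2-\|\varepsilon\|^2)$ is square integrable, and the following hold. (a) $\operatorname{Var}\big(\mathrm{SURE}-\mathbb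 E\|\mu-\hat\mu\|^2+(n\sigma^2-\|\varepsilon\|^2)\big)\le 4\,\mathbb E\big[\sigma^2\,\mathrm{SURE}+\sigma^4\,\hat{\mathsf{df}}\big]$. (b) There exist non-negative random variables $X_n,Y_n$ with $\mathbb E[X_n^2]=\mathbb E[Y_n^2]=1$ such that, almost surely, $$\frac{\big|\mathrm{SURE}-\mathbb E\|\mu-\hat\mu\|^2+(n\sigma^2-\|\varepsilon\|^2)\big|}{\sigma^2\sqrt n}\le X_n\Big[\hat\gamma_n^{1/2}+\frac{4Y_n}{\sqrt n}+\sqrt{4Y_n}\,(6/n)^{1/4}\Big].$$ (c) For $\alpha\in(0,1)$ there is a unique $v_\alpha\in\mathbb R$ with $\mathbb P\{(2n)^{-1/2}|\chi^2_n-n|>v_\alpha\}=\alpha$, where $\chi^2_n$ has the chi-square distribution with $n$ degrees of freedom. For all $\alpha,\beta_1,\beta_2>0$ with $\alpha+\beta_1+\beta_2=\delta<1$, and with $\kappa_{n,\beta_2}=2\big(6/(\beta_2 n)\big)^{1/4}+4/(\beta_2 n)^{1/2}$, $$\mathbb P\bigg\{\frac{\big|\mathrm{SURE}-\mathbb E\|\mu-\hat\mu\|^2\big|}{\sigma^2\sqrt{2n}}\le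 v_\alpha+\frac{\hat\gamma_n^{1/2}+\kappa_{n,\beta_2}}{(2\beta_1)^{1/2}}\bigg\}\ge 1-\delta .$$ (d) Parts (b) (with possibly different $X_n,Y_n$) and (c) remain true with $\mathbb E\|\mu-\hat\mu\|^2$ replaced by $\|\mu-\hat\mu\|^2$. -/

import Mathlib

open MeasureTheory ProbabilityTheory

noncomputable section

/-- The gradient matrix `∇f` of `f : ℝⁿ → ℝⁿ` at `x`: its `i`-th column is the gradient of the
component `f_i`, so the `(j, i)` entry is `∂f_i / ∂x_j`. -/
def gradMatrix {n : ℕ} (f : EuclideanSpace ℝ (Fin n) → EuclideanSpace ℝ (Fin n))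
    (x : EuclideanSpace ℝ (Fin n)) : Matrix (Fin n) (Fin n) ℝ :=
  Matrix.of fun j i => (fderiv ℝ f x (EuclideanSpace.single j (1 : ℝ))) i

/-- The divergence `div f (x) = trace (∇f (x)) = ∑ i, ∂f_i / ∂x_i`. For an estimator `f` of the
mean, evaluated at the observation, this is the empirical degrees of freedom. -/
def divergence {n : ℕ} (f : EuclideanSpace ℝ (Fin n) → EuclideanSpace ℝ (Fin n))
    (x : EuclideanSpace ℝ (Fin n)) : ℝ :=
  (gradMatrix f x).trace

/-- Stein's unbiased risk estimate `‖y - f(y)‖² + 2σ² div f(y) - σ² n`. -/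
def sure {n : ℕ} (σ : ℝ) (f : EuclideanSpace ℝ (Fin n) → EuclideanSpace ℝ (Fin n))
    (y : EuclideanSpace ℝ (Fin n)) : ℝ :=
  ‖y - f y‖ ^ 2 + 2 * σ ^ 2 * divergence f y - σ ^ 2 * n

/-- `γ̂ = 4 (SURE / (nσ²) + trace (∇f) / n)₊`. -/
def gammaHat {n : ℕ} (σ : ℝ) (f : EuclideanSpace ℝ (Fin n) → EuclideanSpace ℝ (Fin n))
    (y : EuclideanSpace ℝ (Fin n)) : ℝ :=
  4 * max (sure σ f y / (n * σ ^ 2) + (gradMatrix f y).trace / n) 0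

/-- `κ_{n,β} = 2 (6 / (βn))^{1/4} + 4 / (βn)^{1/2}`. -/
def kappa (n : ℕ) (β : ℝ) : ℝ :=
  2 * (6 / (β * n)) ^ (1 / 4 : ℝ) + 4 / √(β * n)

/-- The chi-square distribution with `n` degrees of freedom: the law of `‖z‖²`, `z ~ N(0, I_n)`. -/
def chiSquare (n : ℕ) : Measure ℝ :=
  (stdGaussian (EuclideanSpace ℝ (Fin n))).map fun z => ‖z‖ ^ 2

/-- `v` is the two-sided critical value `v_α`: `P((2n)^{-1/2} |χ²_n - n| > v) = α`. -/
def IsChiSquareCritical (n : ℕ) (α v : ℝ) : Prop :=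
  (chiSquare n).real {q | v < |q - n| / √(2 * n)} = α

end

/-! Put `z = ε/σ` and `g(x) = (μhat(μ + σx) - μ)/σ`. The noise becomes standard Gaussian, the loss
becomes `σ²‖g(z)‖²`, and with the Gaussian divergence `δF(x) = ⟪x, F x⟫ - tr DF(x)` the quantity to
control is `σ²(‖g‖² - E‖g‖² - 2 δg)`: the term `nσ² - ‖ε‖²` cancels the `‖x‖² - n` contained in
SURE.

Everything rests on one inequality for a function `Q` and a field `F`, `Var(Q + δF) ≤ E[‖∇Q + F‖² +
tr((DF)²)]` (`SmoothField.variance_le`). Stein's identity makes `δ` adjoint to the gradient, so `E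
δF = 0` and `E[Q δF] = E⟪∇Q, F⟫`; commuting a derivative past `δ` gives `E(δF)² = E[‖F‖² +
tr((DF)²)]`; and `Var Q ≤ E‖∇Q‖²` is the Gaussian Poincaré inequality. Mollification carries the
result over to Lipschitz `g` (`integral_sub_sq_le_jetBound`).

Let `A = Dg`. Almost surely `0 ≤ A ≤ 1`, so `A² ≤ A` and `(1 - A)² ≤ 1`. Write `T` for normalised
SURE plus `tr A`, so that `E T = E[‖g‖² + tr A]`. Three choices of `(Q, F)` are used. The pair
`(‖g‖², -2g)` gives the bound `4 E T` of (a); `(0, -2g)` gives the same bound when centring at the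
loss; `(⟪x, g⟫, x - g)` shows that `‖x‖² + tr A` has variance at most `5n`.

For (b), `T - E T` is the sum of the first and third centred variables, so its standard deviation is
at most `√(4 E T) + √(6n)`. Writing `|T - E T|` as `Y` times that deviation gives a quadratic
inequality for `√(4 E T / n)`, whose solution replaces the unknown `E T` by the observed `T`
(`sqrt_le_of_deviation`). For (c), a union bound combines Markov's inequality for `X²` and `Y²` with
the exact tail of `‖z‖² - n`. -/

open Filter Topology
open scoped RealInnerProductSpace ENNReal NNReal

/-! ### Functions of polynomial growth, the integrability class for Gaussian measures. -/

section PolyGrowth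

variable {E F G H : Type*} [NormedAddCommGroup E] [NormedAddCommGroup F] [NormedAddCommGroup G]
  [NormedAddCommGroup H]

/-- `f` grows at most polynomially. -/
def PolyGrowth (f : E → F) : Prop :=
  ∃ C : ℝ, ∃ k : ℕ, 0 ≤ C ∧ ∀ x, ‖f x‖ ≤ C * (1 + ‖x‖) ^ k

namespace PolyGrowth

lemma mono {f : E → F} {g : E → G} (hg : PolyGrowth g) (h : ∀ x, ‖f x‖ ≤ ‖g x‖) :
    PolyGrowth f := by
  obtain ⟨C, k, hC, hb⟩ := hg
  exact ⟨C, k, hC, fun x => (h x).trans (hb x)⟩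

lemma of_bounded {f : E → F} {C : ℝ} (h : ∀ x, ‖f x‖ ≤ C) : PolyGrowth f :=
  ⟨C, 0, (norm_nonneg _).trans (h 0), fun x => by simpa using h x⟩

lemma const (c : F) : PolyGrowth (fun _ : E => c) := of_bounded fun _ => le_rfl

lemma id : PolyGrowth (fun x : E => x) :=
  ⟨1, 1, zero_le_one, fun x => by simp⟩

lemma norm {f : E → F} (hf : PolyGrowth f) : PolyGrowth (fun x => ‖f x‖) :=
  hf.mono fun x => by simp

lemma add {f g : E → F} (hf : PolyGrowth f) (hg : PolyGrowth g) :
    PolyGrowth (fun x => f x + g x) := by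
  obtain ⟨C, k, hC, hb⟩ := hf
  obtain ⟨D, l, hD, hb'⟩ := hg
  refine ⟨C + D, max k l, add_nonneg hC hD, fun x => (norm_add_le _ _).trans ?_⟩
  have h1 : 1 ≤ 1 + ‖x‖ := by simp
  rw [add_mul]
  refine add_le_add ((hb x).trans ?_) ((hb' x).trans ?_)
  · exact mul_le_mul_of_nonneg_left (pow_le_pow_right₀ h1 (le_max_left _ _)) hC
  · exact mul_le_mul_of_nonneg_left (pow_le_pow_right₀ h1 (le_max_right _ _)) hD

lemma neg {f : E → F} (hf : PolyGrowth f) : PolyGrowth (fun x => -f x) :=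
  hf.mono fun x => by simp

lemma sub {f g : E → F} (hf : PolyGrowth f) (hg : PolyGrowth g) :
    PolyGrowth (fun x => f x - g x) := by
  simpa only [sub_eq_add_neg] using hf.add hg.neg

lemma mul {f g : E → ℝ} (hf : PolyGrowth f) (hg : PolyGrowth g) :
    PolyGrowth (fun x => f x * g x) := by
  obtain ⟨C, k, hC, hb⟩ := hf
  obtain ⟨D, l, hD, hb'⟩ := hg
  refine ⟨C * D, k + l, mul_nonneg hC hD, fun x => ?_⟩
  rw [norm_mul, pow_add, mul_mul_mul_comm]
  gcongr
  exacts [hb x, hb' x]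

lemma pow {f : E → ℝ} (hf : PolyGrowth f) (m : ℕ) : PolyGrowth (fun x => f x ^ m) := by
  induction m with
  | zero => simpa using const (1 : ℝ)
  | succ m ih => simpa only [pow_succ] using ih.mul hf

lemma sum {ι : Type*} (s : Finset ι) {f : ι → E → F} (hf : ∀ i ∈ s, PolyGrowth (f i)) :
    PolyGrowth (fun x => ∑ i ∈ s, f i x) := by
  classical
  induction s using Finset.induction_on with
  | empty => simpa using const (0 : F)
  | insert a s ha ih =>
    simp only [Finset.sum_insert ha]
    exact (hf a (by simp)).add (ih fun i hi => hf i (by simp [hi]))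

lemma smul [NormedSpace ℝ F] {f : E → ℝ} {g : E → F} (hf : PolyGrowth f) (hg : PolyGrowth g) :
    PolyGrowth (fun x => f x • g x) :=
  (hf.norm.mul hg.norm).mono fun x => by simp [norm_smul]

lemma const_mul {f : E → ℝ} (hf : PolyGrowth f) (c : ℝ) : PolyGrowth (fun x => c * f x) :=
  (const c).mul hf

lemma inner [InnerProductSpace ℝ F] {f g : E → F} (hf : PolyGrowth f) (hg : PolyGrowth g) :
    PolyGrowth (fun x => ⟪f x, g x⟫) :=
  (hf.norm.mul hg.norm).mono fun x => by simpa using abs_real_inner_le_norm (f x) (g x)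

lemma clm_apply [NormedSpace ℝ F] [NormedSpace ℝ G] {f : E → F →L[ℝ] G} {g : E → F}
    (hf : PolyGrowth f) (hg : PolyGrowth g) : PolyGrowth (fun x => f x (g x)) :=
  (hf.norm.mul hg.norm).mono fun x => by simpa using (f x).le_opNorm (g x)

lemma comp {f : F → G} {g : E → F} (hf : PolyGrowth f) (hg : PolyGrowth g) :
    PolyGrowth (fun x => f (g x)) := by
  obtain ⟨C, k, hC, hb⟩ := hf
  have : PolyGrowth fun x => C * (1 + ‖g x‖) ^ k := (((const 1).add hg.norm).pow k).const_mul C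
  exact this.mono fun x => (hb (g x)).trans (le_abs_self _)

lemma prodMk {f : E → F} {g : E → G} (hf : PolyGrowth f) (hg : PolyGrowth g) :
    PolyGrowth (fun x => (f x, g x)) := by
  refine (hf.norm.add hg.norm).mono fun x => ?_
  rw [Prod.norm_def, Real.norm_of_nonneg (by positivity)]
  exact max_le_add_of_nonneg (norm_nonneg _) (norm_nonneg _)

lemma fst : PolyGrowth (fun p : E × F => p.1) := id.mono fun p => norm_fst_le p

lemma snd : PolyGrowth (fun p : E × F => p.2) := id.mono fun p => norm_snd_le p

lemma of_lipschitz {K : ℝ≥0} {f : E → F} (hf : LipschitzWith K f) : PolyGrowth f := by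
  refine ((const ‖f 0‖).add ((id.norm).const_mul K)).mono fun x => ?_
  rw [Real.norm_of_nonneg (by positivity)]
  have h := hf.norm_sub_le x 0
  have h2 := norm_le_norm_add_norm_sub' (f x) (f 0)
  rw [sub_zero] at h
  linarith

variable [NormedSpace ℝ E] [MeasurableSpace E] [BorelSpace E] [CompleteSpace E]
  [SecondCountableTopology E]

lemma integrable {f : E → F} (hf : PolyGrowth f) (μ : Measure E) [IsGaussian μ]
    (hm : AEStronglyMeasurable f μ) : Integrable f μ := by
  obtain ⟨C, k, hC, hb⟩ := hf
  have h1 : MemLp (fun x : E => 1 + ‖x‖) k μ :=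
    MemLp.add (f := fun _ : E => (1 : ℝ)) (g := fun x : E => ‖x‖) (memLp_const (1 : ℝ))
      (IsGaussian.memLp_id μ k (ENNReal.natCast_ne_top k)).norm
  have h2 : Integrable (fun x : E => ‖1 + ‖x‖‖ ^ k) μ := h1.integrable_norm_pow'
  refine (h2.const_mul C).mono' hm (ae_of_all _ fun x => ?_)
  rw [Real.norm_of_nonneg (r := 1 + ‖x‖) (by positivity)]
  exact hb x

lemma memLp_two {f : E → ℝ} (hf : PolyGrowth f) (μ : Measure E) [IsGaussian μ]
    (hm : AEStronglyMeasurable f μ) : MemLp f 2 μ :=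
  (memLp_two_iff_integrable_sq hm).2 ((hf.pow 2).integrable μ (hm.pow 2))

end PolyGrowth

end PolyGrowth

/-! ### Gaussian density and Stein's identity. -/

section Stein

set_option linter.unusedSectionVars false

variable {E : Type*} [NormedAddCommGroup E] [InnerProductSpace ℝ E] [FiniteDimensional ℝ E]
  [MeasurableSpace E] [BorelSpace E]

variable (E) in
/-- The density of the standard Gaussian measure. -/
noncomputable def gaussDensity (x : E) : ℝ :=
  ((2 * Real.pi) ^ (Module.finrank ℝ E / 2 : ℝ))⁻¹ * Real.exp (-(1 / 2) * ‖x‖ ^ 2)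

lemma gaussDensity_pos (x : E) : 0 < gaussDensity E x := by
  unfold gaussDensity; positivity

lemma continuous_gaussDensity : Continuous (gaussDensity E) := by
  unfold gaussDensity; fun_prop

lemma integral_gaussDensity : ∫ x : E, gaussDensity E x = 1 := by
  have h := GaussianFourier.integral_rexp_neg_mul_sq_norm (V := E) (b := 1 / 2) (by norm_num)
  have e : Real.pi / (1 / 2) = 2 * Real.pi := by ring
  simp only [gaussDensity]
  rw [integral_const_mul, h, e, inv_mul_cancel₀ (by positivity)]

lemma integrable_gaussDensity : Integrable (gaussDensity E) := by
  by_contra h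
  simpa [integral_undef h] using integral_gaussDensity (E := E)

/-- Both measures have characteristic function `exp(-‖t‖²/2)`; for the density this is the Gaussian
Fourier integral. -/
lemma stdGaussian_eq_withDensity :
    stdGaussian E = volume.withDensity fun x : E => ENNReal.ofReal (gaussDensity E x) := by
  have hfin : IsFiniteMeasure
      (volume.withDensity fun x : E => ENNReal.ofReal (gaussDensity E x)) :=
    isFiniteMeasure_withDensity_ofReal integrable_gaussDensity.2
  apply Measure.ext_of_charFun
  ext t
  rw [charFun_stdGaussian, charFun_apply,
    integral_withDensity_eq_integral_toReal_smul (by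
      exact continuous_gaussDensity.measurable.ennreal_ofReal) (by simp)]
  have h := GaussianFourier.integral_cexp_neg_mul_sq_norm_add (V := E) (b := 1 / 2)
    (by norm_num) Complex.I t
  have e : (fun x : E => (ENNReal.ofReal (gaussDensity E x)).toReal •
      Complex.exp (⟪x, t⟫ * Complex.I)) = fun x =>
      (((2 * Real.pi) ^ (Module.finrank ℝ E / 2 : ℝ))⁻¹ : ℝ) *
        Complex.exp (-(1 / 2) * ‖x‖ ^ 2 + Complex.I * ⟪t, x⟫) := by
    ext x
    rw [ENNReal.toReal_ofReal (gaussDensity_pos x).le, gaussDensity, real_inner_comm,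
      Complex.real_smul, Complex.exp_add]
    push_cast
    rw [mul_comm Complex.I, mul_assoc]
  rw [e, integral_const_mul, h]
  have e2 : ((Real.pi : ℂ) / (1 / 2)) ^ (Module.finrank ℝ E / 2 : ℂ) =
      (((2 * Real.pi) ^ (Module.finrank ℝ E / 2 : ℝ) : ℝ) : ℂ) := by
    rw [Complex.ofReal_cpow (by positivity)]
    push_cast
    congr 1
    ring
  rw [e2, ← mul_assoc, ← Complex.ofReal_mul, inv_mul_cancel₀ (by positivity)]
  simp only [Complex.I_sq, Complex.ofReal_one, one_mul]
  congr 1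
  ring

lemma stdGaussian_absolutelyContinuous : stdGaussian E ≪ volume := by
  rw [stdGaussian_eq_withDensity]
  exact withDensity_absolutelyContinuous _ _

/-- The density is positive everywhere. This is what later gives nonempty open sets positive
Gaussian mass. -/
lemma absolutelyContinuous_stdGaussian : (volume : Measure E) ≪ stdGaussian E := by
  rw [stdGaussian_eq_withDensity]
  refine withDensity_absolutelyContinuous' ?_ (ae_of_all _ fun x => ?_)
  · exact continuous_gaussDensity.measurable.ennreal_ofReal.aemeasurable
  · simpa using gaussDensity_pos x

lemma integral_stdGaussian_eq (f : E → ℝ) :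
    ∫ x, f x ∂(stdGaussian E) = ∫ x, gaussDensity E x * f x := by
  rw [stdGaussian_eq_withDensity, integral_withDensity_eq_integral_toReal_smul
    (by exact continuous_gaussDensity.measurable.ennreal_ofReal) (by simp)]
  simp [ENNReal.toReal_ofReal (gaussDensity_pos _).le]

lemma integrable_stdGaussian_iff (f : E → ℝ) :
    Integrable f (stdGaussian E) ↔ Integrable (fun x => gaussDensity E x * f x) := by
  rw [stdGaussian_eq_withDensity, integrable_withDensity_iff_integrable_smul'
    (by exact continuous_gaussDensity.measurable.ennreal_ofReal) (by simp)]
  simp [ENNReal.toReal_ofReal (gaussDensity_pos _).le]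

lemma hasFDerivAt_gaussDensity (x : E) :
    HasFDerivAt (gaussDensity E) (-(gaussDensity E x) • innerSL ℝ x) x := by
  have h := ((((hasStrictFDerivAt_norm_sq x).hasFDerivAt).const_mul (-(1 / 2) : ℝ)).exp).const_mul
    ((2 * Real.pi) ^ (Module.finrank ℝ E / 2 : ℝ))⁻¹
  refine h.congr_fderiv ?_
  ext v
  simp [gaussDensity]
  ring

lemma PolyGrowth.aestronglyMeasurable_fderiv_apply (h : E → ℝ) (v : E) (μ : Measure E) :
    AEStronglyMeasurable (fun x => fderiv ℝ h x v) μ :=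
  (measurable_fderiv_apply_const ℝ h v).aestronglyMeasurable

/-- **Stein's identity** for differentiable functions of polynomial growth. -/
lemma stein_identity {h : E → ℝ} (hd : Differentiable ℝ h) (hp : PolyGrowth h)
    (hp' : PolyGrowth (fderiv ℝ h)) (v : E) :
    ∫ x, ⟪x, v⟫ * h x ∂(stdGaussian E) = ∫ x, fderiv ℝ h x v ∂(stdGaussian E) := by
  have i1 : Integrable (fun x => fderiv ℝ h x v) (stdGaussian E) :=
    (hp'.clm_apply (PolyGrowth.const v)).integrable _
      (PolyGrowth.aestronglyMeasurable_fderiv_apply h v _)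
  have i2 : Integrable (fun x => ⟪x, v⟫ * h x) (stdGaussian E) :=
    ((PolyGrowth.id.inner (PolyGrowth.const v)).mul hp).integrable _
      (by have := hd.continuous; exact Continuous.aestronglyMeasurable (by fun_prop))
  have i3 : Integrable h (stdGaussian E) :=
    hp.integrable _ hd.continuous.aestronglyMeasurable
  rw [integrable_stdGaussian_iff] at i1 i2 i3
  rw [integral_stdGaussian_eq, integral_stdGaussian_eq]
  -- The density `ρ` satisfies `∂_v ρ = -⟪x, v⟫ ρ`, so the identity is an integration by parts
  -- against `ρ`.
  have e : ∀ x, fderiv ℝ (gaussDensity E) x v * h x = -(gaussDensity E x * (⟪x, v⟫ * h x)) := by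
    intro x
    rw [(hasFDerivAt_gaussDensity x).fderiv]
    simp
    ring
  rw [integral_mul_fderiv_eq_neg_fderiv_mul_of_integrable (by simp only [e]; exact i2.neg) i1 i3
    (fun x _ => (hasFDerivAt_gaussDensity x).differentiableAt) (fun x _ => hd x)]
  simp only [e, integral_neg, neg_neg]

/-- The directional divergence of a scalar function with respect to the standard Gaussian. -/
noncomputable def steinDiv (v : E) (a : E → ℝ) (x : E) : ℝ := ⟪x, v⟫ * a x - fderiv ℝ a x v

/-- `steinDiv v` is adjoint to the derivative in direction `v`. -/
lemma integral_steinDiv_mul {a b : E → ℝ} (ha : Differentiable ℝ a) (hb : Differentiable ℝ b)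
    (pa : PolyGrowth a) (pa' : PolyGrowth (fderiv ℝ a)) (pb : PolyGrowth b)
    (pb' : PolyGrowth (fderiv ℝ b)) (v : E) :
    ∫ x, steinDiv v a x * b x ∂(stdGaussian E) =
      ∫ x, a x * fderiv ℝ b x v ∂(stdGaussian E) := by
  have hf : ∀ x, fderiv ℝ (fun x => a x * b x) x = a x • fderiv ℝ b x + b x • fderiv ℝ a x :=
    fun x => fderiv_fun_mul (ha x) (hb x)
  have pab' : PolyGrowth (fderiv ℝ fun x => a x * b x) := by
    have : fderiv ℝ (fun x => a x * b x) = fun x => a x • fderiv ℝ b x + b x • fderiv ℝ a x :=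
      funext hf
    rw [this]
    exact (pa.smul pb').add (pb.smul pa')
  -- Stein's identity for the product `a b`; the Leibniz rule separates the two derivatives.
  have h := stein_identity (ha.mul hb) (pa.mul pb) pab' v
  have ca := ha.continuous
  have cb := hb.continuous
  have i1 : Integrable (fun x => ⟪x, v⟫ * (a x * b x)) (stdGaussian E) :=
    ((PolyGrowth.id.inner (PolyGrowth.const v)).mul (pa.mul pb)).integrable _
      (Continuous.aestronglyMeasurable (by fun_prop))
  have i2 : Integrable (fun x => fderiv ℝ a x v * b x) (stdGaussian E) :=
    ((pa'.clm_apply (PolyGrowth.const v)).mul pb).integrable _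
      ((PolyGrowth.aestronglyMeasurable_fderiv_apply a v _).mul cb.aestronglyMeasurable)
  have i3 : Integrable (fun x => a x * fderiv ℝ b x v) (stdGaussian E) :=
    (pa.mul (pb'.clm_apply (PolyGrowth.const v))).integrable _
      (ca.aestronglyMeasurable.mul (PolyGrowth.aestronglyMeasurable_fderiv_apply b v _))
  have e : ∀ x, steinDiv v a x * b x = ⟪x, v⟫ * (a x * b x) - fderiv ℝ a x v * b x := fun x => by
    simp only [steinDiv]; ring
  simp only [e]
  rw [integral_sub i1 i2]
  simp only [Pi.mul_apply] at h
  rw [show (∫ x, ⟪x, v⟫ * (a x * b x) ∂stdGaussian E) = _ from h]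
  rw [sub_eq_iff_eq_add, ← integral_add i3 i2]
  refine integral_congr_ae (ae_of_all _ fun x => ?_)
  change fderiv ℝ (fun x => a x * b x) x v = _
  rw [hf]
  simp [mul_comm]

end Stein

/-! ### The second order Stein formula for scalar functions. -/

section SecondOrder

set_option linter.unusedSectionVars false

variable {E : Type*} [NormedAddCommGroup E] [InnerProductSpace ℝ E] [FiniteDimensional ℝ E]
  [MeasurableSpace E] [BorelSpace E]

lemma PolyGrowth.fderiv_of_fderiv_apply {a : E → ℝ} (h : ∀ v, PolyGrowth fun x => fderiv ℝ a x v) :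
    PolyGrowth (fderiv ℝ a) := by
  let b := stdOrthonormalBasis ℝ E
  have := PolyGrowth.sum Finset.univ (f := fun i x => ‖fderiv ℝ a x (b i)‖)
    fun i _ => (h (b i)).norm
  refine this.mono fun x => ?_
  rw [Real.norm_of_nonneg (by positivity)]
  refine ContinuousLinearMap.opNorm_le_bound _ (by positivity) fun v => ?_
  conv_lhs => rw [← b.sum_repr v, map_sum]
  refine (norm_sum_le _ _).trans ?_
  rw [Finset.sum_mul]
  refine Finset.sum_le_sum fun i _ => ?_
  rw [map_smul, norm_smul, mul_comm]
  gcongr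
  rw [b.repr_apply_apply]
  simpa using abs_real_inner_le_norm (b i) v

/-- The regularity needed of the scalar functions entering the second order Stein formula. -/
structure SmoothPG (a : E → ℝ) : Prop where
  contDiff : ContDiff ℝ 2 a
  pg : PolyGrowth a
  pg_fderiv : PolyGrowth (fderiv ℝ a)
  pg_fderiv2 : ∀ v w, PolyGrowth fun x => fderiv ℝ (fun x => fderiv ℝ a x v) x w

namespace SmoothPG

variable {a b : E → ℝ}

lemma differentiable (ha : SmoothPG a) : Differentiable ℝ a :=
  ha.contDiff.differentiable (by norm_num)

lemma contDiff_fderiv_apply (ha : SmoothPG a) (v : E) : ContDiff ℝ 1 fun x => fderiv ℝ a x v :=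
  (ha.contDiff.fderiv_right (m := 1) (by norm_num)).clm_apply contDiff_const

lemma differentiable_fderiv_apply (ha : SmoothPG a) (v : E) :
    Differentiable ℝ fun x => fderiv ℝ a x v :=
  (ha.contDiff_fderiv_apply v).differentiable (by norm_num)

lemma pg_fderiv_apply (ha : SmoothPG a) (v : E) : PolyGrowth fun x => fderiv ℝ a x v :=
  ha.pg_fderiv.clm_apply (PolyGrowth.const v)

lemma pg_fderiv_fderiv_apply (ha : SmoothPG a) (v : E) :
    PolyGrowth (fderiv ℝ fun x => fderiv ℝ a x v) :=
  PolyGrowth.fderiv_of_fderiv_apply (ha.pg_fderiv2 v)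

lemma continuous_steinDiv (ha : SmoothPG a) (v : E) : Continuous (steinDiv v a) := by
  have h1 := ha.contDiff.continuous
  have h2 := (ha.contDiff_fderiv_apply v).continuous
  unfold steinDiv
  fun_prop

lemma pg_steinDiv (ha : SmoothPG a) (v : E) : PolyGrowth (steinDiv v a) :=
  ((PolyGrowth.id.inner (PolyGrowth.const v)).mul ha.pg).sub (ha.pg_fderiv_apply v)

lemma hasFDerivAt_steinDiv (ha : SmoothPG a) (v x : E) :
    HasFDerivAt (steinDiv v a) (⟪x, v⟫ • fderiv ℝ a x + a x • innerSL ℝ v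
      - fderiv ℝ (fun x => fderiv ℝ a x v) x) x := by
  have h1 : HasFDerivAt (fun x : E => ⟪x, v⟫) (innerSL ℝ v) x := by
    simpa only [real_inner_comm v, coe_innerSL_apply] using (innerSL ℝ v).hasFDerivAt (x := x)
  exact (h1.mul (ha.differentiable x).hasFDerivAt).sub
    (ha.differentiable_fderiv_apply v x).hasFDerivAt

/-- The commutation relation between a derivative and the Gaussian divergence: the extra term comes
from differentiating `⟪x, v⟫`, and symmetry of the second derivative lets `D_w` pass through `D_v`.
-/
lemma fderiv_steinDiv (ha : SmoothPG a) (v w x : E) :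
    fderiv ℝ (steinDiv v a) x w = ⟪v, w⟫ * a x + steinDiv v (fun x => fderiv ℝ a x w) x := by
  have hs : fderiv ℝ (fun x => fderiv ℝ a x v) x w = fderiv ℝ (fun x => fderiv ℝ a x w) x v := by
    have hd : DifferentiableAt ℝ (fderiv ℝ a) x :=
      (ha.contDiff.fderiv_right (m := 1) (by norm_num)).differentiable (by norm_num) x
    rw [fderiv_clm_apply hd (differentiableAt_const v),
      fderiv_clm_apply hd (differentiableAt_const w)]
    simpa using (ha.contDiff.contDiffAt.isSymmSndFDerivAt (by simp)) w v
  rw [(ha.hasFDerivAt_steinDiv v x).fderiv]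
  simp only [steinDiv, ← hs]
  simp
  ring

lemma pg_fderiv_steinDiv (ha : SmoothPG a) (v : E) : PolyGrowth (fderiv ℝ (steinDiv v a)) := by
  refine PolyGrowth.fderiv_of_fderiv_apply fun w => ?_
  simp only [ha.fderiv_steinDiv]
  exact (ha.pg.const_mul _).add
    (((PolyGrowth.id.inner (PolyGrowth.const v)).mul (ha.pg_fderiv_apply w)).sub
      (ha.pg_fderiv2 w v))

/-- **Second order Stein formula** for scalar functions. -/
lemma integral_steinDiv_mul_steinDiv (ha : SmoothPG a) (hb : SmoothPG b) (v w : E) :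
    ∫ x, steinDiv v a x * steinDiv w b x ∂(stdGaussian E) =
      ⟪v, w⟫ * ∫ x, a x * b x ∂(stdGaussian E) +
        ∫ x, fderiv ℝ a x w * fderiv ℝ b x v ∂(stdGaussian E) := by
  rw [integral_steinDiv_mul ha.differentiable
    (fun x => (hb.hasFDerivAt_steinDiv w x).differentiableAt) ha.pg ha.pg_fderiv
    (hb.pg_steinDiv w) (hb.pg_fderiv_steinDiv w)]
  -- Adjointness is used twice: first to move `steinDiv v` off `a`, then, after commuting, to move
  -- `steinDiv w` back onto `a` as a derivative.
  have h := integral_steinDiv_mul (hb.differentiable_fderiv_apply v) ha.differentiable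
    (hb.pg_fderiv_apply v) (hb.pg_fderiv_fderiv_apply v) ha.pg ha.pg_fderiv w
  have e : ∀ x, a x * fderiv ℝ (steinDiv w b) x v =
      ⟪v, w⟫ * (a x * b x) + steinDiv w (fun x => fderiv ℝ b x v) x * a x := fun x => by
    rw [hb.fderiv_steinDiv, real_inner_comm w v]; ring
  have ca := ha.contDiff.continuous
  have cb := hb.contDiff.continuous
  have c2 : Continuous (steinDiv w fun x => fderiv ℝ b x v) := by
    have h1 := (hb.contDiff_fderiv_apply v)
    have h2 : Continuous fun x => fderiv ℝ (fun x => fderiv ℝ b x v) x w :=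
      (h1.continuous_fderiv (by norm_num)).clm_apply continuous_const
    have h3 := h1.continuous
    unfold steinDiv
    fun_prop
  have i1 : Integrable (fun x => ⟪v, w⟫ * (a x * b x)) (stdGaussian E) :=
    ((ha.pg.mul hb.pg).const_mul _).integrable _ (Continuous.aestronglyMeasurable (by fun_prop))
  have i2 : Integrable (fun x => steinDiv w (fun x => fderiv ℝ b x v) x * a x) (stdGaussian E) :=
    ((((PolyGrowth.id.inner (PolyGrowth.const w)).mul (hb.pg_fderiv_apply v)).sub
      (hb.pg_fderiv2 v w)).mul ha.pg).integrable _ (c2.mul ca).aestronglyMeasurable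
  simp only [e]
  rw [integral_add i1 i2, integral_const_mul, h]
  simp only [mul_comm]

end SmoothPG

end SecondOrder

/-! ### The Gaussian Poincaré inequality by rotation of two independent copies. -/

section Poincare

set_option linter.unusedSectionVars false

open scoped Gradient

variable {E : Type*} [NormedAddCommGroup E] [InnerProductSpace ℝ E] [FiniteDimensional ℝ E]
  [MeasurableSpace E] [BorelSpace E]

lemma norm_gradient (h : E → ℝ) (x : E) : ‖∇ h x‖ = ‖fderiv ℝ h x‖ := by
  simp [gradient]

lemma map_rotation_stdGaussian (θ : ℝ) :
    ((stdGaussian E).prod (stdGaussian E)).map (ContinuousLinearMap.rotation θ) =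
      (stdGaussian E).prod (stdGaussian E) :=
  IsGaussian.map_rotation_eq_self (by simp) θ

/-- Correlation of `h` along a rotation of two independent Gaussian vectors. -/
noncomputable def rotCorr (h : E → ℝ) (θ : ℝ) : ℝ :=
  ∫ p, h p.1 * h (Real.cos θ • p.1 + Real.sin θ • p.2) ∂((stdGaussian E).prod (stdGaussian E))

lemma integral_prod_rotation (θ : ℝ) {f : E × E → ℝ} (hf : Continuous f) :
    ∫ p, f (ContinuousLinearMap.rotation θ p) ∂((stdGaussian E).prod (stdGaussian E)) =
      ∫ p, f p ∂((stdGaussian E).prod (stdGaussian E)) := by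
  conv_rhs => rw [← map_rotation_stdGaussian θ]
  rw [integral_map (by fun_prop) hf.aestronglyMeasurable]

lemma PolyGrowth.rot {f : E → ℝ} (hf : PolyGrowth f) (θ : ℝ) :
    PolyGrowth fun p : E × E => f (Real.cos θ • p.1 + Real.sin θ • p.2) :=
  hf.comp (((PolyGrowth.const _).smul PolyGrowth.fst).add ((PolyGrowth.const _).smul PolyGrowth.snd))

variable {h : E → ℝ}

lemma rotCorr_zero :
    rotCorr h 0 = ∫ x, h x ^ 2 ∂(stdGaussian E) := by
  have := integral_fun_fst (μ := stdGaussian E) (ν := stdGaussian E) (fun x => h x ^ 2)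
  simp [rotCorr, ← sq, this]

lemma rotCorr_pi_div_two : rotCorr h (Real.pi / 2) = (∫ x, h x ∂(stdGaussian E)) ^ 2 := by
  simp [rotCorr, integral_prod_mul, sq]

lemma hasDerivAt_rotCorr (hc : ContDiff ℝ 1 h) (hp : PolyGrowth h) (hp' : PolyGrowth (fderiv ℝ h))
    (θ : ℝ) : HasDerivAt (rotCorr h)
      (∫ p, h p.1 * fderiv ℝ h (Real.cos θ • p.1 + Real.sin θ • p.2)
        (-Real.sin θ • p.1 + Real.cos θ • p.2) ∂((stdGaussian E).prod (stdGaussian E))) θ := by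
  obtain ⟨C, k, hC, hb⟩ := hp'
  have c0 := hc.continuous
  have c1 : Continuous (fderiv ℝ h) := hc.continuous_fderiv (by norm_num)
  -- Uniform in the angle, so one dominating function serves for every `θ`.
  have hn : ∀ (s c : ℝ) (p : E × E), |s| ≤ 1 → |c| ≤ 1 → ‖c • p.1 + s • p.2‖ ≤ 2 * ‖p‖ := by
    intro s c p hs hc
    refine (norm_add_le _ _).trans ?_
    rw [norm_smul, norm_smul, Real.norm_eq_abs, Real.norm_eq_abs, two_mul]
    exact add_le_add
      ((mul_le_of_le_one_left (norm_nonneg _) hc).trans (norm_fst_le p))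
      ((mul_le_of_le_one_left (norm_nonneg _) hs).trans (norm_snd_le p))
  refine (hasDerivAt_integral_of_dominated_loc_of_deriv_le
    (bound := fun p : E × E => ‖h p.1‖ * (C * (1 + 2 * ‖p‖) ^ k * (2 * ‖p‖)))
    (F' := fun θ (p : E × E) => h p.1 * fderiv ℝ h (Real.cos θ • p.1 + Real.sin θ • p.2)
        (-Real.sin θ • p.1 + Real.cos θ • p.2)) univ_mem ?_ ?_ ?_ ?_ ?_ ?_).2
  · exact Eventually.of_forall fun t => Continuous.aestronglyMeasurable (by fun_prop)
  · exact ((hp.comp PolyGrowth.fst).mul (hp.rot θ)).integrable _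
      (Continuous.aestronglyMeasurable (by fun_prop))
  · exact Continuous.aestronglyMeasurable (by fun_prop)
  · refine ae_of_all _ fun p t _ => ?_
    rw [norm_mul]
    gcongr
    refine (ContinuousLinearMap.le_opNorm _ _).trans ?_
    have n1 := hn (Real.sin t) (Real.cos t) p (Real.abs_sin_le_one t) (Real.abs_cos_le_one t)
    have n2 := hn (Real.cos t) (-Real.sin t) p (Real.abs_cos_le_one t)
      (by simpa using Real.abs_sin_le_one t)
    refine mul_le_mul ((hb _).trans ?_) n2 (norm_nonneg _) (by positivity)
    gcongr
  · refine PolyGrowth.integrable ?_ _ (Continuous.aestronglyMeasurable (by fun_prop))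
    have h2 : PolyGrowth fun p : E × E => 2 * ‖p‖ := PolyGrowth.id.norm.const_mul 2
    exact (hp.comp PolyGrowth.fst).norm.mul
      (((((PolyGrowth.const 1).add h2).pow k).const_mul C).mul h2)
  · refine ae_of_all _ fun p t _ => ?_
    have d1 : HasDerivAt (fun t => Real.cos t • p.1 + Real.sin t • p.2)
        (-Real.sin t • p.1 + Real.cos t • p.2) t :=
      ((Real.hasDerivAt_cos t).smul_const p.1).add ((Real.hasDerivAt_sin t).smul_const p.2)
    have d2 := ((hc.differentiable (by norm_num)) (Real.cos t • p.1 + Real.sin t • p.2)).hasFDerivAt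
    exact (d2.comp_hasDerivAt t d1).const_mul (h p.1)

/-- Rotating `(U, V)` by `-θ` preserves its law and turns the integral into `E[h(cU - sV) ⟪V,
∇h(U)⟫]`. Stein's identity in `V` alone makes this `-s E⟪∇h(cU - sV), ∇h(U)⟫`. Both gradients have
the same second moment, so Cauchy–Schwarz and `2ab ≤ a² + b²` finish. -/
lemma deriv_rotCorr_ge (hc : ContDiff ℝ 1 h) (hp : PolyGrowth h) (hp' : PolyGrowth (fderiv ℝ h))
    {θ : ℝ} (hθ : 0 ≤ Real.sin θ) :
    -Real.sin θ * ∫ x, ‖∇ h x‖ ^ 2 ∂(stdGaussian E) ≤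
      ∫ p, h p.1 * fderiv ℝ h (Real.cos θ • p.1 + Real.sin θ • p.2)
        (-Real.sin θ • p.1 + Real.cos θ • p.2) ∂((stdGaussian E).prod (stdGaussian E)) := by
  have c0 := hc.continuous
  have c1 : Continuous (fderiv ℝ h) := hc.continuous_fderiv (by norm_num)
  have cg : Continuous (∇ h) := (InnerProductSpace.toDual ℝ E).symm.continuous.comp c1
  have pg : PolyGrowth (∇ h) := hp'.mono fun x => (norm_gradient h x).le
  have hd : Differentiable ℝ h := hc.differentiable (by norm_num)
  set s := Real.sin θ with hs
  set c := Real.cos θ with hcos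
  have prot : PolyGrowth fun p : E × E => c • p.1 + (-s) • p.2 :=
    ((PolyGrowth.const _).smul PolyGrowth.fst).add ((PolyGrowth.const _).smul PolyGrowth.snd)
  have r1 := integral_prod_rotation (-θ) (E := E)
    (f := fun p => h p.1 * fderiv ℝ h (c • p.1 + s • p.2) (-s • p.1 + c • p.2)) (by fun_prop)
  rw [← r1]
  have cs : c * c + s * s = 1 := by
    have := Real.sin_sq_add_cos_sq θ
    rw [← hs, ← hcos] at this; linarith
  have e1 : ∀ p : E × E, c • (c • p.1 + (-s) • p.2) + s • (-(-s) • p.1 + c • p.2) = p.1 := by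
    intro p
    have : c • (c • p.1 + (-s) • p.2) + s • (-(-s) • p.1 + c • p.2) = (c * c + s * s) • p.1 := by
      module
    rw [this, cs, one_smul]
  have e2 : ∀ p : E × E, -s • (c • p.1 + (-s) • p.2) + c • (-(-s) • p.1 + c • p.2) = p.2 := by
    intro p
    have : -s • (c • p.1 + (-s) • p.2) + c • (-(-s) • p.1 + c • p.2) = (c * c + s * s) • p.2 := by
      module
    rw [this, cs, one_smul]
  have e3 : ∀ p : E × E, h (ContinuousLinearMap.rotation (-θ) p).1 * fderiv ℝ h
      (c • (ContinuousLinearMap.rotation (-θ) p).1 + s • (ContinuousLinearMap.rotation (-θ) p).2)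
      (-s • (ContinuousLinearMap.rotation (-θ) p).1 + c • (ContinuousLinearMap.rotation (-θ) p).2) =
      ⟪p.2, ∇ h p.1⟫ * h (c • p.1 + (-s) • p.2) := by
    intro p
    simp only [ContinuousLinearMap.rotation_apply, Real.cos_neg, Real.sin_neg]
    rw [← hs, ← hcos, e1, e2, real_inner_comm, inner_gradient_left, mul_comm]
  simp only [e3]
  have i1 : Integrable (fun p : E × E => ⟪p.2, ∇ h p.1⟫ * h (c • p.1 + (-s) • p.2))
      ((stdGaussian E).prod (stdGaussian E)) :=
    ((PolyGrowth.snd.inner (pg.comp PolyGrowth.fst)).mul (hp.comp prot)).integrable _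
      (Continuous.aestronglyMeasurable (by fun_prop))
  have i2 : Integrable (fun p : E × E => -s * fderiv ℝ h (c • p.1 + (-s) • p.2) (∇ h p.1))
      ((stdGaussian E).prod (stdGaussian E)) :=
    (((hp'.comp prot).clm_apply (pg.comp PolyGrowth.fst)).const_mul _).integrable _
      (Continuous.aestronglyMeasurable (by fun_prop))
  have st : ∫ p, ⟪p.2, ∇ h p.1⟫ * h (c • p.1 + (-s) • p.2)
        ∂((stdGaussian E).prod (stdGaussian E)) =
      ∫ p, -s * fderiv ℝ h (c • p.1 + (-s) • p.2) (∇ h p.1)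
        ∂((stdGaussian E).prod (stdGaussian E)) := by
    rw [integral_prod _ i1, integral_prod _ i2]
    refine integral_congr_ae (ae_of_all _ fun u => ?_)
    have hk : ∀ v, HasFDerivAt (fun v => h (c • u + (-s) • v))
        ((-s) • fderiv ℝ h (c • u + (-s) • v)) v := by
      intro v
      have d1 : HasFDerivAt (fun v : E => c • u + (-s) • v)
          ((-s) • ContinuousLinearMap.id ℝ E) v :=
        ((hasFDerivAt_id v).const_smul (-s)).const_add (c • u)
      refine ((hd _).hasFDerivAt.comp v d1).congr_fderiv ?_
      ext w; simp
    have pr : PolyGrowth fun v : E => c • u + (-s) • v :=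
      (PolyGrowth.const _).add ((PolyGrowth.const _).smul PolyGrowth.id)
    have hk' : fderiv ℝ (fun v => h (c • u + (-s) • v)) =
        fun v => (-s) • fderiv ℝ h (c • u + (-s) • v) := funext fun v => (hk v).fderiv
    have := stein_identity (h := fun v => h (c • u + (-s) • v)) (fun v => (hk v).differentiableAt)
      (hp.comp pr) (by rw [hk']; exact (PolyGrowth.const _).smul (hp'.comp pr)) (∇ h u)
    simpa only [hk', _root_.smul_apply, smul_eq_mul] using this
  rw [st, integral_const_mul, neg_mul, neg_mul, neg_le_neg_iff]
  refine mul_le_mul_of_nonneg_left ?_ hθ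
  have pq : PolyGrowth fun x => ‖∇ h x‖ ^ 2 := pg.norm.pow 2
  have j1 : Integrable (fun p : E × E => ‖∇ h p.1‖ ^ 2) ((stdGaussian E).prod (stdGaussian E)) :=
    (pq.comp PolyGrowth.fst).integrable _ (Continuous.aestronglyMeasurable (by fun_prop))
  have j2 : Integrable (fun p : E × E => ‖∇ h (c • p.1 + (-s) • p.2)‖ ^ 2)
      ((stdGaussian E).prod (stdGaussian E)) :=
    (pq.comp prot).integrable _ (Continuous.aestronglyMeasurable (by fun_prop))
  have j0 : Integrable (fun p : E × E => fderiv ℝ h (c • p.1 + (-s) • p.2) (∇ h p.1))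
      ((stdGaussian E).prod (stdGaussian E)) :=
    ((hp'.comp prot).clm_apply (pg.comp PolyGrowth.fst)).integrable _
      (Continuous.aestronglyMeasurable (by fun_prop))
  have k1 : ∫ p : E × E, ‖∇ h p.1‖ ^ 2 ∂((stdGaussian E).prod (stdGaussian E)) =
      ∫ x, ‖∇ h x‖ ^ 2 ∂(stdGaussian E) := by
    have := integral_fun_fst (μ := stdGaussian E) (ν := stdGaussian E) (fun x => ‖∇ h x‖ ^ 2)
    simpa using this
  have k2 : ∫ p : E × E, ‖∇ h (c • p.1 + (-s) • p.2)‖ ^ 2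
      ∂((stdGaussian E).prod (stdGaussian E)) = ∫ x, ‖∇ h x‖ ^ 2 ∂(stdGaussian E) := by
    rw [← k1, ← integral_prod_rotation (-θ) (f := fun p : E × E => ‖∇ h p.1‖ ^ 2) (by fun_prop)]
    simp only [ContinuousLinearMap.rotation_apply, Real.cos_neg, Real.sin_neg]
    rfl
  calc _ ≤ ∫ p : E × E, (1 / 2 * ‖∇ h (c • p.1 + (-s) • p.2)‖ ^ 2 + 1 / 2 * ‖∇ h p.1‖ ^ 2)
      ∂((stdGaussian E).prod (stdGaussian E)) := by
        refine integral_mono j0 ((j2.const_mul _).add (j1.const_mul _)) fun p => ?_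
        have := (fderiv ℝ h (c • p.1 + (-s) • p.2)).le_opNorm (∇ h p.1)
        have h2 := le_abs_self (fderiv ℝ h (c • p.1 + (-s) • p.2) (∇ h p.1))
        rw [Real.norm_eq_abs, ← norm_gradient] at this
        dsimp only
        nlinarith [sq_nonneg (‖∇ h (c • p.1 + (-s) • p.2)‖ - ‖∇ h p.1‖)]
    _ = _ := by
        rw [integral_add (j2.const_mul _) (j1.const_mul _), integral_const_mul, integral_const_mul,
          k1, k2]
        ring

/-- The **Gaussian Poincaré inequality** for `C¹` functions of polynomial growth. -/
theorem gaussian_poincare (hc : ContDiff ℝ 1 h) (hp : PolyGrowth h)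
    (hp' : PolyGrowth (fderiv ℝ h)) :
    ∫ x, h x ^ 2 ∂(stdGaussian E) - (∫ x, h x ∂(stdGaussian E)) ^ 2 ≤
      ∫ x, ‖∇ h x‖ ^ 2 ∂(stdGaussian E) := by
  set A := ∫ x, ‖∇ h x‖ ^ 2 ∂(stdGaussian E) with hA
  have hd : ∀ θ, HasDerivAt (fun θ => rotCorr h θ - A * Real.cos θ)
      (_ - A * -Real.sin θ) θ := fun θ =>
    (hasDerivAt_rotCorr hc hp hp' θ).sub ((Real.hasDerivAt_cos θ).const_mul A)
  -- The values at the two endpoints are `E h² - A` and `(E h)²`, so monotonicity is exactly the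
  -- claim.
  have hm : MonotoneOn (fun θ => rotCorr h θ - A * Real.cos θ) (Set.Icc 0 (Real.pi / 2)) := by
    refine monotoneOn_of_deriv_nonneg (convex_Icc _ _)
      (fun θ _ => (hd θ).continuousAt.continuousWithinAt)
      (fun θ _ => (hd θ).differentiableAt.differentiableWithinAt) fun θ hθ => ?_
    rw [interior_Icc] at hθ
    rw [(hd θ).deriv]
    have := deriv_rotCorr_ge hc hp hp' (θ := θ)
      (Real.sin_nonneg_of_nonneg_of_le_pi hθ.1.le (by linarith [hθ.2, Real.pi_pos]))
    rw [← hA] at this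
    linarith
  have := hm (Set.left_mem_Icc.2 (by positivity)) (Set.right_mem_Icc.2 (by positivity))
    (by positivity)
  simp only [rotCorr_zero, rotCorr_pi_div_two, Real.cos_zero,
    Real.cos_pi_div_two] at this
  linarith

end Poincare

/-! ### Second order Poincaré inequality for a function plus a Gaussian divergence. -/

section VarianceBound

set_option linter.unusedSectionVars false

open scoped Gradient

variable {E : Type*} [NormedAddCommGroup E] [InnerProductSpace ℝ E] [FiniteDimensional ℝ E]
  [MeasurableSpace E] [BorelSpace E] {ι : Type*} [Fintype ι]

namespace SmoothPG

lemma add {a b : E → ℝ} (ha : SmoothPG a) (hb : SmoothPG b) : SmoothPG fun x => a x + b x := by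
  have e : ∀ x, fderiv ℝ (fun x => a x + b x) x = fderiv ℝ a x + fderiv ℝ b x := fun x =>
    fderiv_fun_add (ha.differentiable x) (hb.differentiable x)
  refine ⟨ha.contDiff.add hb.contDiff, ha.pg.add hb.pg, ?_, fun v w => ?_⟩
  · rw [funext e]
    exact ha.pg_fderiv.add hb.pg_fderiv
  · simp only [e, _root_.add_apply]
    have : ∀ x, fderiv ℝ (fun x => fderiv ℝ a x v + fderiv ℝ b x v) x =
        fderiv ℝ (fun x => fderiv ℝ a x v) x + fderiv ℝ (fun x => fderiv ℝ b x v) x := fun x =>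
      fderiv_fun_add (ha.differentiable_fderiv_apply v x) (hb.differentiable_fderiv_apply v x)
    simp only [this, _root_.add_apply]
    exact (ha.pg_fderiv2 v w).add (hb.pg_fderiv2 v w)

lemma const_mul {a : E → ℝ} (ha : SmoothPG a) (c : ℝ) : SmoothPG fun x => c * a x := by
  have e : ∀ x, fderiv ℝ (fun x => c * a x) x = c • fderiv ℝ a x := fun x =>
    fderiv_const_mul (ha.differentiable x) c
  refine ⟨contDiff_const.mul ha.contDiff, ha.pg.const_mul c, ?_, fun v w => ?_⟩
  · rw [funext e]
    exact (PolyGrowth.const c).smul ha.pg_fderiv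
  · simp only [e, _root_.smul_apply, smul_eq_mul]
    have : ∀ x, fderiv ℝ (fun x => c * fderiv ℝ a x v) x = c • fderiv ℝ (fun x => fderiv ℝ a x v) x :=
      fun x => fderiv_const_mul (ha.differentiable_fderiv_apply v x) c
    simp only [this, _root_.smul_apply, smul_eq_mul]
    exact (ha.pg_fderiv2 v w).const_mul c

lemma inner_right (u : E) : SmoothPG fun x => ⟪x, u⟫ := by
  have e : ∀ x, fderiv ℝ (fun x => ⟪x, u⟫) x = innerSL ℝ u := fun x => by
    have : HasFDerivAt (fun x : E => ⟪x, u⟫) (innerSL ℝ u) x := by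
      simpa only [real_inner_comm u, coe_innerSL_apply] using (innerSL ℝ u).hasFDerivAt (x := x)
    exact this.fderiv
  refine ⟨contDiff_id.inner ℝ contDiff_const, PolyGrowth.id.inner (PolyGrowth.const u), ?_, fun v w => ?_⟩
  · rw [funext e]; exact PolyGrowth.const _
  · simp only [e]
    simpa using PolyGrowth.const (0 : ℝ)

end SmoothPG

/-- The trace of an operator, computed in an orthonormal basis. -/
noncomputable def basisTrace (b : OrthonormalBasis ι ℝ E) (A : E →L[ℝ] E) : ℝ := ∑ i, ⟪A (b i), b i⟫

/-- The trace of the square of an operator, computed in an orthonormal basis. -/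
noncomputable def basisTraceSq (b : OrthonormalBasis ι ℝ E) (A : E →L[ℝ] E) : ℝ :=
  ∑ i, ∑ j, ⟪A (b i), b j⟫ * ⟪A (b j), b i⟫

/-- Regularity of a vector field, expressed through its coordinates. -/
structure SmoothField (b : OrthonormalBasis ι ℝ E) (F : E → E) : Prop where
  differentiable : Differentiable ℝ F
  coord : ∀ i, SmoothPG fun x => ⟪F x, b i⟫

namespace SmoothField

variable {b : OrthonormalBasis ι ℝ E} {F : E → E}

lemma fderiv_coord (hF : SmoothField b F) (i : ι) (x v : E) :
    fderiv ℝ (fun x => ⟪F x, b i⟫) x v = ⟪fderiv ℝ F x v, b i⟫ := by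
  have h := ((innerSL ℝ (b i)).hasFDerivAt (x := F x)).comp x (hF.differentiable x).hasFDerivAt
  have h2 : HasFDerivAt (fun x => ⟪F x, b i⟫) ((innerSL ℝ (b i)).comp (fderiv ℝ F x)) x := by
    refine h.congr_of_eventuallyEq (Eventually.of_forall fun y => ?_)
    simp [real_inner_comm]
  rw [h2.fderiv]
  simp [real_inner_comm]

lemma sum_steinDiv (hF : SmoothField b F) (x : E) :
    ∑ i, steinDiv (b i) (fun x => ⟪F x, b i⟫) x = ⟪x, F x⟫ - basisTrace b (fderiv ℝ F x) := by
  simp only [steinDiv, hF.fderiv_coord, Finset.sum_sub_distrib, basisTrace]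
  rw [← b.sum_inner_mul_inner x (F x)]
  simp only [real_inner_comm (b _) (F x)]

lemma integrable_steinDiv_mul (hF : SmoothField b F) (i : ι) {Q : E → ℝ} (hQ : Continuous Q)
    (hp : PolyGrowth Q) :
    Integrable (fun x => steinDiv (b i) (fun x => ⟪F x, b i⟫) x * Q x) (stdGaussian E) :=
  (((hF.coord i).pg_steinDiv (b i)).mul hp).integrable _
    (((hF.coord i).continuous_steinDiv (b i)).mul hQ).aestronglyMeasurable

/-- The divergence of a field is the sum of the scalar divergences of its coordinates, so scalar
adjointness can be summed over the basis. -/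
lemma integral_mul_div (hF : SmoothField b F) {Q : E → ℝ} (hQ : ContDiff ℝ 1 Q)
    (hp : PolyGrowth Q) (hp' : PolyGrowth (fderiv ℝ Q)) :
    ∫ x, (⟪x, F x⟫ - basisTrace b (fderiv ℝ F x)) * Q x ∂(stdGaussian E) =
      ∫ x, ⟪∇ Q x, F x⟫ ∂(stdGaussian E) := by
  simp only [← hF.sum_steinDiv, Finset.sum_mul]
  rw [integral_finsetSum _ fun i _ => hF.integrable_steinDiv_mul i hQ.continuous hp]
  have hd := hQ.differentiable (by norm_num)
  have h1 : ∀ i, ∫ x, steinDiv (b i) (fun x => ⟪F x, b i⟫) x * Q x ∂(stdGaussian E) =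
      ∫ x, ⟪F x, b i⟫ * fderiv ℝ Q x (b i) ∂(stdGaussian E) := fun i =>
    integral_steinDiv_mul (hF.coord i).differentiable hd (hF.coord i).pg (hF.coord i).pg_fderiv
      hp hp' (b i)
  simp only [h1]
  rw [← integral_finsetSum]
  · refine integral_congr_ae (ae_of_all _ fun x => ?_)
    simp only
    rw [real_inner_comm, ← b.sum_inner_mul_inner (F x)]
    refine Finset.sum_congr rfl fun i _ => ?_
    rw [real_inner_comm (∇ Q x), inner_gradient_left]
  · intro i _
    exact ((hF.coord i).pg.mul (hp'.clm_apply (PolyGrowth.const _))).integrable _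
      ((hF.coord i).contDiff.continuous.mul
        ((hQ.continuous_fderiv (by norm_num)).clm_apply continuous_const)).aestronglyMeasurable

lemma integral_div (hF : SmoothField b F) :
    ∫ x, (⟪x, F x⟫ - basisTrace b (fderiv ℝ F x)) ∂(stdGaussian E) = 0 := by
  have := hF.integral_mul_div (Q := fun _ => 1) contDiff_const (PolyGrowth.const 1)
    (PolyGrowth.of_bounded (C := 0) (by simp))
  simpa [gradient] using this

lemma integral_div_sq (hF : SmoothField b F) :
    ∫ x, (⟪x, F x⟫ - basisTrace b (fderiv ℝ F x)) ^ 2 ∂(stdGaussian E) =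
      ∫ x, (‖F x‖ ^ 2 + basisTraceSq b (fderiv ℝ F x)) ∂(stdGaussian E) := by
  classical
  simp only [← hF.sum_steinDiv, sq (∑ i, _), Finset.sum_mul_sum]
  have hc : ∀ i, Continuous (steinDiv (b i) fun x => ⟪F x, b i⟫) :=
    fun i => (hF.coord i).continuous_steinDiv (b i)
  have hi : ∀ i j, Integrable (fun x => steinDiv (b i) (fun x => ⟪F x, b i⟫) x *
      steinDiv (b j) (fun x => ⟪F x, b j⟫) x) (stdGaussian E) := fun i j =>
    hF.integrable_steinDiv_mul i (hc j) ((hF.coord j).pg_steinDiv (b j))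
  have k1 : ∀ i j, Integrable (fun x => ⟪b i, b j⟫ * (⟪F x, b i⟫ * ⟪F x, b j⟫)) (stdGaussian E) :=
    fun i j => (((hF.coord i).pg.mul (hF.coord j).pg).const_mul _).integrable _
      (continuous_const.mul ((hF.coord i).contDiff.continuous.mul
        (hF.coord j).contDiff.continuous)).aestronglyMeasurable
  have k2 : ∀ i j, Integrable (fun x => ⟪fderiv ℝ F x (b j), b i⟫ * ⟪fderiv ℝ F x (b i), b j⟫)
      (stdGaussian E) := fun i j => by
    simp only [← hF.fderiv_coord]
    exact (((hF.coord i).pg_fderiv_apply _).mul ((hF.coord j).pg_fderiv_apply _)).integrable _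
      (((hF.coord i).contDiff_fderiv_apply _).continuous.mul
        ((hF.coord j).contDiff_fderiv_apply _).continuous).aestronglyMeasurable
  have h2 : ∀ i j, ∫ x, steinDiv (b i) (fun x => ⟪F x, b i⟫) x *
      steinDiv (b j) (fun x => ⟪F x, b j⟫) x ∂(stdGaussian E) =
      ∫ x, (⟪b i, b j⟫ * (⟪F x, b i⟫ * ⟪F x, b j⟫) +
        ⟪fderiv ℝ F x (b j), b i⟫ * ⟪fderiv ℝ F x (b i), b j⟫) ∂(stdGaussian E) := fun i j => by
    rw [SmoothPG.integral_steinDiv_mul_steinDiv (hF.coord i) (hF.coord j),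
      integral_add (k1 i j) (k2 i j), integral_const_mul]
    simp only [hF.fderiv_coord]
  have k3 : ∀ i j, Integrable (fun x => ⟪b i, b j⟫ * (⟪F x, b i⟫ * ⟪F x, b j⟫) +
      ⟪fderiv ℝ F x (b j), b i⟫ * ⟪fderiv ℝ F x (b i), b j⟫) (stdGaussian E) :=
    fun i j => (k1 i j).add (k2 i j)
  rw [integral_finsetSum _ fun i _ => integrable_finsetSum _ fun j _ => hi i j]
  have h3 : ∀ i, ∫ x, ∑ j, steinDiv (b i) (fun x => ⟪F x, b i⟫) x *
      steinDiv (b j) (fun x => ⟪F x, b j⟫) x ∂(stdGaussian E) =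
      ∫ x, ∑ j, (⟪b i, b j⟫ * (⟪F x, b i⟫ * ⟪F x, b j⟫) +
        ⟪fderiv ℝ F x (b j), b i⟫ * ⟪fderiv ℝ F x (b i), b j⟫) ∂(stdGaussian E) := fun i => by
    rw [integral_finsetSum _ fun j _ => hi i j, integral_finsetSum _ fun j _ => k3 i j]
    exact Finset.sum_congr rfl fun j _ => h2 i j
  simp only [h3]
  rw [← integral_finsetSum _ fun i _ => integrable_finsetSum _ fun j _ => k3 i j]
  refine integral_congr_ae (ae_of_all _ fun x => ?_)
  simp only [Finset.sum_add_distrib, basisTraceSq]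
  congr 1
  -- Orthonormality collapses the double sum of `⟪b i, b j⟫` terms to `‖F‖²`; the remaining terms
  -- are `tr((DF)²)`.
  · simp only [orthonormal_iff_ite.1 b.orthonormal, ite_mul, one_mul, zero_mul, Finset.sum_ite_eq,
      Finset.mem_univ, if_true]
    rw [← real_inner_self_eq_norm_sq, ← b.sum_inner_mul_inner (F x) (F x)]
    simp only [real_inner_comm (b _) (F x)]
  · exact Finset.sum_congr rfl fun i _ => Finset.sum_congr rfl fun j _ => mul_comm _ _

/-- A second order Poincaré inequality for `Q + δF`, with `δ` the Gaussian divergence. -/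
theorem variance_le (hF : SmoothField b F) {Q : E → ℝ} (hQ : ContDiff ℝ 1 Q)
    (hp : PolyGrowth Q) (hp' : PolyGrowth (fderiv ℝ Q)) :
    ∫ x, (Q x + (⟪x, F x⟫ - basisTrace b (fderiv ℝ F x))) ^ 2 ∂(stdGaussian E) -
        (∫ x, Q x ∂(stdGaussian E)) ^ 2 ≤
      ∫ x, (‖∇ Q x + F x‖ ^ 2 + basisTraceSq b (fderiv ℝ F x)) ∂(stdGaussian E) := by
  have cQ := hQ.continuous
  have cF := hF.differentiable.continuous
  have cQ' := hQ.continuous_fderiv (by norm_num)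
  have cg : Continuous (∇ Q) := (InnerProductSpace.toDual ℝ E).symm.continuous.comp cQ'
  have pg : PolyGrowth (∇ Q) := hp'.mono fun x => (norm_gradient Q x).le
  have cd : Continuous fun x => ⟪x, F x⟫ - basisTrace b (fderiv ℝ F x) := by
    simp only [← hF.sum_steinDiv]
    exact continuous_finsetSum _ fun i _ => (hF.coord i).continuous_steinDiv (b i)
  have pd : PolyGrowth fun x => ⟪x, F x⟫ - basisTrace b (fderiv ℝ F x) := by
    simp only [← hF.sum_steinDiv]
    exact PolyGrowth.sum _ fun i _ => (hF.coord i).pg_steinDiv (b i)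
  have pF : PolyGrowth F := by
    have : PolyGrowth fun x => ∑ i, ⟪F x, b i⟫ • b i :=
      PolyGrowth.sum _ fun i _ => (hF.coord i).pg.smul (PolyGrowth.const _)
    have e : (fun x => ∑ i, ⟪F x, b i⟫ • b i) = F := funext fun x => by
      conv_rhs => rw [← b.sum_repr (F x)]
      simp only [b.repr_apply_apply, real_inner_comm]
    rwa [e] at this
  have cs : Continuous fun x => basisTraceSq b (fderiv ℝ F x) := by
    simp only [basisTraceSq, ← hF.fderiv_coord]
    exact continuous_finsetSum _ fun i _ => continuous_finsetSum _ fun j _ =>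
      ((hF.coord j).contDiff_fderiv_apply _).continuous.mul
        ((hF.coord i).contDiff_fderiv_apply _).continuous
  have ps : PolyGrowth fun x => basisTraceSq b (fderiv ℝ F x) := by
    simp only [basisTraceSq, ← hF.fderiv_coord]
    exact PolyGrowth.sum _ fun i _ => PolyGrowth.sum _ fun j _ =>
      ((hF.coord j).pg_fderiv_apply _).mul ((hF.coord i).pg_fderiv_apply _)
  have i1 : Integrable (fun x => Q x ^ 2) (stdGaussian E) :=
    (hp.pow 2).integrable _ (cQ.pow 2).aestronglyMeasurable
  have i2 : Integrable (fun x => (⟪x, F x⟫ - basisTrace b (fderiv ℝ F x)) ^ 2) (stdGaussian E) :=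
    (pd.pow 2).integrable _ (cd.pow 2).aestronglyMeasurable
  have i3 : Integrable (fun x => (⟪x, F x⟫ - basisTrace b (fderiv ℝ F x)) * Q x) (stdGaussian E) :=
    (pd.mul hp).integrable _ (cd.mul cQ).aestronglyMeasurable
  have i4 : Integrable (fun x => ‖∇ Q x‖ ^ 2) (stdGaussian E) :=
    (pg.norm.pow 2).integrable _ (cg.norm.pow 2).aestronglyMeasurable
  have i5 : Integrable (fun x => ‖F x‖ ^ 2 + basisTraceSq b (fderiv ℝ F x)) (stdGaussian E) :=
    ((pF.norm.pow 2).add ps).integrable _ ((cF.norm.pow 2).add cs).aestronglyMeasurable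
  have i6 : Integrable (fun x => ⟪∇ Q x, F x⟫) (stdGaussian E) :=
    (pg.inner pF).integrable _ (cg.inner cF).aestronglyMeasurable
  have e1 : ∀ x, (Q x + (⟪x, F x⟫ - basisTrace b (fderiv ℝ F x))) ^ 2 =
      Q x ^ 2 + ((⟪x, F x⟫ - basisTrace b (fderiv ℝ F x)) ^ 2 +
        2 * ((⟪x, F x⟫ - basisTrace b (fderiv ℝ F x)) * Q x)) := fun x => by ring
  have e2 : ∀ x, ‖∇ Q x + F x‖ ^ 2 + basisTraceSq b (fderiv ℝ F x) =
      ‖∇ Q x‖ ^ 2 + ((‖F x‖ ^ 2 + basisTraceSq b (fderiv ℝ F x)) + 2 * ⟪∇ Q x, F x⟫) := fun x => by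
    rw [norm_add_sq_real]; ring
  simp only [e1, e2]
  have i7 : Integrable (fun x => (⟪x, F x⟫ - basisTrace b (fderiv ℝ F x)) ^ 2 +
      2 * ((⟪x, F x⟫ - basisTrace b (fderiv ℝ F x)) * Q x)) (stdGaussian E) :=
    i2.add (i3.const_mul 2)
  have i8 : Integrable (fun x => (‖F x‖ ^ 2 + basisTraceSq b (fderiv ℝ F x)) +
      2 * ⟪∇ Q x, F x⟫) (stdGaussian E) := i5.add (i6.const_mul 2)
  -- The cross term `2 E[Q δF] = 2 E⟪∇Q, F⟫` is the one that completes the square `‖∇Q + F‖²`. The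
  -- only inequality used is Poincaré for `Q`.
  rw [integral_add i1 i7, integral_add i2 (i3.const_mul 2),
    integral_add i4 i8, integral_add i5 (i6.const_mul 2),
    hF.integral_div_sq, integral_const_mul, integral_const_mul, hF.integral_mul_div hQ hp hp']
  have := gaussian_poincare hQ hp hp'
  linarith

end SmoothField

end VarianceBound

/-! ### Smoothing a Lipschitz map. -/

section Mollify

set_option linter.unusedSectionVars false

open scoped Convolution
open ContinuousLinearMap

variable {E : Type*} [NormedAddCommGroup E] [InnerProductSpace ℝ E] [FiniteDimensional ℝ E]
  [MeasurableSpace E] [BorelSpace E]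
  {F : Type*} [NormedAddCommGroup F] [NormedSpace ℝ F] [FiniteDimensional ℝ F]
  {K : ℝ≥0} {g : E → F}

/-- Convolution with a normalised bump function. -/
noncomputable def mollify (φ : ContDiffBump (0 : E)) (g : E → F) : E → F :=
  φ.normed volume ⋆[lsmul ℝ ℝ, volume] g

lemma mollify_apply (φ : ContDiffBump (0 : E)) (g : E → F) (x : E) :
    mollify φ g x = ∫ t, φ.normed volume t • g (x - t) := rfl

lemma integrable_normed_smul (φ : ContDiffBump (0 : E)) {g : E → F} (hg : Continuous g) (x : E) :
    Integrable fun t => φ.normed volume t • g (x - t) := by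
  refine Continuous.integrable_of_hasCompactSupport ?_ ?_
  · have := (φ.contDiff_normed (μ := volume) (n := 0)).continuous
    fun_prop
  · exact (φ.hasCompactSupport_normed (μ := volume)).smul_right

lemma integrable_normed (φ : ContDiffBump (0 : E)) : Integrable (φ.normed volume) :=
  (φ.contDiff_normed (μ := volume) (n := 0)).continuous.integrable_of_hasCompactSupport
    φ.hasCompactSupport_normed

lemma contDiff_mollify (φ : ContDiffBump (0 : E)) (hg : Continuous g) {n : ℕ∞} :
    ContDiff ℝ n (mollify φ g) :=
  φ.hasCompactSupport_normed.contDiff_convolution_left _ φ.contDiff_normed hg.locallyIntegrable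

lemma lipschitzWith_mollify (φ : ContDiffBump (0 : E)) (hg : LipschitzWith K g) :
    LipschitzWith K (mollify φ g) := by
  refine LipschitzWith.of_dist_le_mul fun x y => ?_
  rw [dist_eq_norm, dist_eq_norm, mollify_apply, mollify_apply,
    ← integral_sub (integrable_normed_smul φ hg.continuous x)
      (integrable_normed_smul φ hg.continuous y)]
  have h : ∀ t, ‖φ.normed volume t • g (x - t) - φ.normed volume t • g (y - t)‖ ≤
      φ.normed volume t * (K * ‖x - y‖) := fun t => by
    rw [← smul_sub, norm_smul, Real.norm_of_nonneg (φ.nonneg_normed t)]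
    refine mul_le_mul_of_nonneg_left ?_ (φ.nonneg_normed t)
    simpa using hg.norm_sub_le (x - t) (y - t)
  refine (norm_integral_le_of_norm_le ((integrable_normed φ).mul_const _)
    (ae_of_all _ h)).trans ?_
  rw [integral_mul_const, φ.integral_normed, one_mul]

lemma dist_mollify_le (φ : ContDiffBump (0 : E)) (hg : LipschitzWith K g) (x : E) :
    dist (mollify φ g x) (g x) ≤ K * φ.rOut := by
  refine φ.dist_normed_convolution_le hg.continuous.aestronglyMeasurable fun y hy => ?_
  exact (hg.dist_le_mul y x).trans (mul_le_mul_of_nonneg_left (Metric.mem_ball.1 hy).le K.2)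

lemma ae_differentiableAt_sub (hg : LipschitzWith K g) (x : E) :
    ∀ᵐ t : E, DifferentiableAt ℝ g (x - t) :=
  (volume.measurePreserving_sub_left x).quasiMeasurePreserving.ae
    (hg.ae_differentiableAt (μ := volume))

lemma locallyIntegrable_fderiv (hg : LipschitzWith K g) :
    LocallyIntegrable (fderiv ℝ g) (volume : Measure E) := by
  have : LocallyIntegrable (fun _ : E => (K : ℝ)) (volume : Measure E) := locallyIntegrable_const _
  refine this.mono (measurable_fderiv ℝ g).aestronglyMeasurable (ae_of_all _ fun x => ?_)
  simpa using norm_fderiv_le_of_lipschitz ℝ hg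

/-- By Rademacher's theorem `g` is differentiable almost everywhere, so the derivative may fall on
`g` instead of the bump. The derivatives of the mollifications are then mollifications of `fderiv ℝ
g`, hence converge almost everywhere. -/
lemma hasFDerivAt_mollify (φ : ContDiffBump (0 : E)) (hg : LipschitzWith K g) (x : E) :
    HasFDerivAt (mollify φ g) (mollify φ (fderiv ℝ g) x) x := by
  have cφ := (φ.contDiff_normed (μ := volume) (n := 0)).continuous
  refine (hasFDerivAt_integral_of_dominated_loc_of_lip' (s := Set.univ)
    (F := fun x t => φ.normed volume t • g (x - t))
    (F' := fun t => φ.normed volume t • fderiv ℝ g (x - t))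
    (bound := fun t => φ.normed volume t * K) univ_mem ?_ ?_ ?_ ?_ ?_ ?_).2
  · exact fun y _ => (integrable_normed_smul φ hg.continuous y).aestronglyMeasurable
  · exact integrable_normed_smul φ hg.continuous x
  · exact cφ.aestronglyMeasurable.smul
      ((measurable_fderiv ℝ g).comp (measurable_const.sub measurable_id)).aestronglyMeasurable
  · refine ae_of_all _ fun t y _ => ?_
    rw [← smul_sub, norm_smul, Real.norm_of_nonneg (φ.nonneg_normed t), mul_assoc]
    refine mul_le_mul_of_nonneg_left ?_ (φ.nonneg_normed t)
    simpa using hg.norm_sub_le (y - t) (x - t)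
  · exact (integrable_normed φ).mul_const _
  · filter_upwards [ae_differentiableAt_sub hg x] with t ht
    have h1 : HasFDerivAt (fun y : E => y - t) (ContinuousLinearMap.id ℝ E) x :=
      (hasFDerivAt_id x).sub_const t
    exact (ht.hasFDerivAt.comp x h1).const_smul _

lemma fderiv_mollify (φ : ContDiffBump (0 : E)) (hg : LipschitzWith K g) :
    fderiv ℝ (mollify φ g) = mollify φ (fderiv ℝ g) :=
  funext fun x => (hasFDerivAt_mollify φ hg x).fderiv

/-- One derivative falls on `g`, the other on the bump. The bound blows up as the bump shrinks,
which is harmless: second derivatives only justify the smooth formulas and do not occur in the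
limiting inequality. -/
lemma exists_bound_fderiv_fderiv_mollify (φ : ContDiffBump (0 : E)) (hg : LipschitzWith K g) :
    ∃ C, ∀ x, ‖fderiv ℝ (fderiv ℝ (mollify φ g)) x‖ ≤ C := by
  rw [fderiv_mollify φ hg]
  have cφ := φ.contDiff_normed (μ := volume) (n := 1)
  have iφ : Integrable fun t => ‖fderiv ℝ (φ.normed volume) t‖ :=
    ((cφ.continuous_fderiv (by norm_num)).integrable_of_hasCompactSupport
      ((φ.hasCompactSupport_normed (μ := volume)).fderiv ℝ)).norm
  refine ⟨∫ t, ‖fderiv ℝ (φ.normed volume) t‖ * K, fun x => ?_⟩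
  have := φ.hasCompactSupport_normed.hasFDerivAt_convolution_left (lsmul ℝ ℝ) cφ
    (locallyIntegrable_fderiv hg) x
  rw [mollify, this.fderiv]
  refine norm_integral_le_of_norm_le (iφ.mul_const _) (ae_of_all _ fun t => ?_)
  refine ContinuousLinearMap.opNorm_le_bound _ (by positivity) fun v => ?_
  rw [precompL_apply, lsmul_apply, norm_smul, mul_right_comm]
  gcongr
  · exact (fderiv ℝ (φ.normed volume) t).le_opNorm v
  · exact norm_fderiv_le_of_lipschitz ℝ hg

/-- A Lipschitz map is the limit of smooth maps with the same Lipschitz constant, bounded second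
derivatives, and almost everywhere converging derivatives. -/
theorem exists_smooth_approx (hg : LipschitzWith K g) :
    ∃ G : ℕ → E → F, (∀ k, ContDiff ℝ 2 (G k)) ∧ (∀ k, LipschitzWith K (G k)) ∧
      (∀ k, ∃ C, ∀ x, ‖fderiv ℝ (fderiv ℝ (G k)) x‖ ≤ C) ∧
      (∀ k x, ‖G k x - g x‖ ≤ K) ∧ (∀ x, Tendsto (fun k => G k x) atTop (𝓝 (g x))) ∧
      ∀ᵐ x : E, Tendsto (fun k => fderiv ℝ (G k) x) atTop (𝓝 (fderiv ℝ g x)) := by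
  -- The outer radius tends to `0` while its ratio to the inner radius stays equal to `2`; a bounded
  -- ratio is what Lebesgue differentiation requires for almost everywhere convergence.
  let φ : ℕ → ContDiffBump (0 : E) := fun k =>
    ⟨1 / (2 * (k + 1)), 1 / (k + 1), by positivity, by
      gcongr
      linarith [(Nat.cast_nonneg k : (0 : ℝ) ≤ k)]⟩
  have hr : Tendsto (fun k => (φ k).rOut) atTop (𝓝 0) := tendsto_one_div_add_atTop_nhds_zero_nat
  refine ⟨fun k => mollify (φ k) g, fun k => contDiff_mollify (φ k) hg.continuous (n := 2),
    fun k => lipschitzWith_mollify (φ k) hg,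
    fun k => exists_bound_fderiv_fderiv_mollify (φ k) hg, fun k x => ?_, fun x => ?_, ?_⟩
  · rw [← dist_eq_norm]
    refine (dist_mollify_le (φ k) hg x).trans (mul_le_of_le_one_right K.2 ?_)
    change 1 / ((k : ℝ) + 1) ≤ 1
    rw [div_le_one (by positivity)]
    linarith [(Nat.cast_nonneg k : (0 : ℝ) ≤ k)]
  · exact ContDiffBump.convolution_tendsto_right_of_continuous hr hg.continuous x
  · simp only [fderiv_mollify _ hg]
    refine ContDiffBump.ae_convolution_tendsto_right_of_locallyIntegrable (K := 2) hr
      (Eventually.of_forall fun k => ?_) (locallyIntegrable_fderiv hg)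
    change 1 / ((k : ℝ) + 1) ≤ 2 * (1 / (2 * (k + 1)))
    apply le_of_eq
    field_simp

end Mollify

/-! ### Passing to Lipschitz fields through continuous functions of the one-jet. -/

section Lipschitz

set_option linter.unusedSectionVars false

open scoped Gradient

variable {E : Type*} [NormedAddCommGroup E] [InnerProductSpace ℝ E] [FiniteDimensional ℝ E]
  [MeasurableSpace E] [BorelSpace E] {ι : Type*} [Fintype ι] {K : ℝ≥0}

/-- The one-jet of a map. -/
noncomputable def jet (g : E → E) (x : E) : E × E × (E →L[ℝ] E) := (x, g x, fderiv ℝ g x)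

lemma measurable_jet {g : E → E} (hg : LipschitzWith K g) (μ : Measure E) :
    AEStronglyMeasurable (jet g) μ :=
  aestronglyMeasurable_id.prodMk (hg.continuous.aestronglyMeasurable.prodMk
    (measurable_fderiv ℝ g).aestronglyMeasurable)

lemma polyGrowth_jet {g : E → E} (hg : LipschitzWith K g) : PolyGrowth (jet g) :=
  PolyGrowth.id.prodMk ((PolyGrowth.of_lipschitz hg).prodMk
    (PolyGrowth.of_bounded fun _ => norm_fderiv_le_of_lipschitz ℝ hg))

lemma polyGrowth_comp_jet {g : E → E} (hg : LipschitzWith K g)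
    {Φ : E × E × (E →L[ℝ] E) → ℝ} (hp : PolyGrowth Φ) : PolyGrowth fun x => Φ (jet g x) :=
  hp.comp (polyGrowth_jet hg)

lemma memLp_two_comp_jet {g : E → E} (hg : LipschitzWith K g)
    {Φ : E × E × (E →L[ℝ] E) → ℝ} (hc : Continuous Φ) (hp : PolyGrowth Φ) :
    MemLp (fun x => Φ (jet g x)) 2 (stdGaussian E) :=
  (polyGrowth_comp_jet hg hp).memLp_two _ (hc.comp_aestronglyMeasurable (measurable_jet hg _))

lemma integrable_comp_jet {g : E → E} (hg : LipschitzWith K g)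
    {Φ : E × E × (E →L[ℝ] E) → ℝ} (hc : Continuous Φ) (hp : PolyGrowth Φ) :
    Integrable (fun x => Φ (jet g x)) (stdGaussian E) :=
  (polyGrowth_comp_jet hg hp).integrable _ (hc.comp_aestronglyMeasurable (measurable_jet hg _))

/-- Every integrand in the variance inequality is a continuous function of polynomial growth of `(x,
g x, Dg x)`. The uniform Lipschitz and distance bounds dominate the jets, so this one limit theorem
serves all of them. -/
lemma tendsto_integral_jet {g : E → E} (hg : LipschitzWith K g) {G : ℕ → E → E}
    (hL : ∀ k, LipschitzWith K (G k)) (hd : ∀ k x, ‖G k x - g x‖ ≤ K)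
    (ht : ∀ x, Tendsto (fun k => G k x) atTop (𝓝 (g x)))
    (ht' : ∀ᵐ x : E, Tendsto (fun k => fderiv ℝ (G k) x) atTop (𝓝 (fderiv ℝ g x)))
    {Φ : E × E × (E →L[ℝ] E) → ℝ} (hc : Continuous Φ) (hp : PolyGrowth Φ) :
    Tendsto (fun k => ∫ x, Φ (jet (G k) x) ∂(stdGaussian E)) atTop
      (𝓝 (∫ x, Φ (jet g x) ∂(stdGaussian E))) := by
  obtain ⟨C, m, hC, hb⟩ := hp
  refine tendsto_integral_of_dominated_convergence
    (fun x => C * (1 + (‖x‖ + (‖g x‖ + K) + K)) ^ m) ?_ ?_ ?_ ?_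
  · exact fun k => hc.comp_aestronglyMeasurable (measurable_jet (hL k) _)
  · have cg := hg.continuous
    refine PolyGrowth.integrable ?_ _ (Continuous.aestronglyMeasurable (by fun_prop))
    exact (((PolyGrowth.const 1).add ((PolyGrowth.id.norm.add
      ((PolyGrowth.of_lipschitz hg).norm.add (PolyGrowth.const _))).add
        (PolyGrowth.const _))).pow m).const_mul C
  · refine fun k => ae_of_all _ fun x => (hb _).trans ?_
    have h1 : ‖G k x‖ ≤ ‖g x‖ + K :=
      (norm_le_norm_add_norm_sub' (G k x) (g x)).trans (by gcongr; exact hd k x)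
    have h2 : ‖fderiv ℝ (G k) x‖ ≤ K := norm_fderiv_le_of_lipschitz ℝ (hL k)
    have h3 : ‖jet (G k) x‖ ≤ ‖x‖ + (‖g x‖ + K) + K := by
      simp only [jet, Prod.norm_def]
      refine max_le ?_ (max_le (h1.trans ?_) (h2.trans ?_)) <;>
        linarith [norm_nonneg x, norm_nonneg (g x), K.2, NNReal.coe_nonneg K]
    gcongr
  · filter_upwards [stdGaussian_absolutelyContinuous.ae_le ht'] with x hx
    exact (hc.tendsto _).comp (tendsto_const_nhds.prodMk_nhds ((ht x).prodMk_nhds hx))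

variable (b : OrthonormalBasis ι ℝ E) (α β c e : ℝ)

/-- The quadratic function `α ‖u‖² + β ⟪x, u⟫`. -/
noncomputable def jetQuad (p : E × E × (E →L[ℝ] E)) : ℝ := α * ‖p.2.1‖ ^ 2 + β * ⟪p.1, p.2.1⟫

/-- The Gaussian divergence of `c x + e g(x)` as a function of the jet of `g`. -/
noncomputable def jetDiv (p : E × E × (E →L[ℝ] E)) : ℝ :=
  ⟪p.1, c • p.1 + e • p.2.1⟫ - basisTrace b (c • ContinuousLinearMap.id ℝ E + e • p.2.2)

/-- The integrand bounding the variance of `jetQuad + jetDiv`. -/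
noncomputable def jetBound (p : E × E × (E →L[ℝ] E)) : ℝ :=
  ‖((2 * α) • p.2.2.adjoint p.2.1 + β • (p.2.1 + p.2.2.adjoint p.1)) + (c • p.1 + e • p.2.1)‖ ^ 2
    + basisTraceSq b (c • ContinuousLinearMap.id ℝ E + e • p.2.2)

lemma continuous_jetQuad : Continuous (jetQuad (E := E) α β) := by
  unfold jetQuad; fun_prop

lemma continuous_jetDiv : Continuous (jetDiv b c e) := by
  unfold jetDiv basisTrace; fun_prop

lemma continuous_jetBound : Continuous (jetBound b α β c e) := by
  have : Continuous fun A : E →L[ℝ] E => A.adjoint := ContinuousLinearMap.adjoint.continuous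
  unfold jetBound basisTraceSq; fun_prop

lemma polyGrowth_jetQuad : PolyGrowth (jetQuad (E := E) α β) :=
  (((PolyGrowth.fst.comp PolyGrowth.snd).norm.pow 2).const_mul α).add
    ((PolyGrowth.fst.inner (PolyGrowth.fst.comp PolyGrowth.snd)).const_mul β)

lemma polyGrowth_affine : PolyGrowth fun p : E × E × (E →L[ℝ] E) =>
    c • ContinuousLinearMap.id ℝ E + e • p.2.2 :=
  (PolyGrowth.const _).add ((PolyGrowth.const e).smul (PolyGrowth.snd.comp PolyGrowth.snd))

lemma polyGrowth_jetDiv : PolyGrowth (jetDiv b c e) := by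
  refine (PolyGrowth.fst.inner (((PolyGrowth.const c).smul PolyGrowth.fst).add
    ((PolyGrowth.const e).smul (PolyGrowth.fst.comp PolyGrowth.snd)))).sub ?_
  exact PolyGrowth.sum _ fun i _ =>
    ((polyGrowth_affine c e).clm_apply (PolyGrowth.const _)).inner (PolyGrowth.const _)

lemma polyGrowth_jetBound : PolyGrowth (jetBound b α β c e) := by
  have p1 : PolyGrowth fun p : E × E × (E →L[ℝ] E) => p.1 := PolyGrowth.fst
  have p2 : PolyGrowth fun p : E × E × (E →L[ℝ] E) => p.2.1 := PolyGrowth.fst.comp PolyGrowth.snd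
  have p3 : PolyGrowth fun p : E × E × (E →L[ℝ] E) => p.2.2.adjoint :=
    (PolyGrowth.snd.comp PolyGrowth.snd : PolyGrowth fun p : E × E × (E →L[ℝ] E) => p.2.2).mono
      fun p => by simp
  refine PolyGrowth.add (PolyGrowth.pow (PolyGrowth.norm ((((PolyGrowth.const _).smul
    (p3.clm_apply p2)).add ((PolyGrowth.const _).smul (p2.add (p3.clm_apply p1)))).add
      (((PolyGrowth.const c).smul p1).add ((PolyGrowth.const e).smul p2)))) 2) ?_
  exact PolyGrowth.sum _ fun i _ => PolyGrowth.sum _ fun j _ =>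
    (((polyGrowth_affine c e).clm_apply (PolyGrowth.const _)).inner (PolyGrowth.const _)).mul
    (((polyGrowth_affine c e).clm_apply (PolyGrowth.const _)).inner (PolyGrowth.const _))

section Smooth

variable {b α β c e} {G : E → E}

lemma smoothPG_inner (hG : ContDiff ℝ 2 G) (hL : LipschitzWith K G) {C : ℝ}
    (hC : ∀ x, ‖fderiv ℝ (fderiv ℝ G) x‖ ≤ C) (u : E) : SmoothPG fun x => ⟪G x, u⟫ := by
  have hd : Differentiable ℝ G := hG.differentiable (by norm_num)
  have hd2 : Differentiable ℝ (fderiv ℝ G) :=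
    (hG.fderiv_right (m := 1) (by norm_num)).differentiable (by norm_num)
  have e1 : ∀ x v, fderiv ℝ (fun x => ⟪G x, u⟫) x v = ⟪fderiv ℝ G x v, u⟫ := fun x v => by
    rw [fderiv_inner_apply ℝ (hd x) (differentiableAt_const u)]
    simp
  have pb : PolyGrowth (fderiv ℝ G) :=
    PolyGrowth.of_bounded fun _ => norm_fderiv_le_of_lipschitz ℝ hL
  refine ⟨hG.inner ℝ contDiff_const, (PolyGrowth.of_lipschitz hL).inner (PolyGrowth.const u),
    PolyGrowth.fderiv_of_fderiv_apply fun v => ?_, fun v w => ?_⟩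
  · simp only [e1]
    exact (pb.clm_apply (PolyGrowth.const v)).inner (PolyGrowth.const u)
  · simp only [e1]
    have e2 : ∀ x, fderiv ℝ (fun x => ⟪fderiv ℝ G x v, u⟫) x w =
        ⟪fderiv ℝ (fderiv ℝ G) x w v, u⟫ := fun x => by
      rw [fderiv_inner_apply ℝ ((hd2 x).clm_apply (differentiableAt_const v))
        (differentiableAt_const u), fderiv_clm_apply (hd2 x) (differentiableAt_const v)]
      simp
    simp only [e2]
    exact (((PolyGrowth.of_bounded hC).clm_apply (PolyGrowth.const w)).clm_apply
      (PolyGrowth.const v)).inner (PolyGrowth.const u)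

lemma smoothField_affine (hG : ContDiff ℝ 2 G) (hL : LipschitzWith K G) {C : ℝ}
    (hC : ∀ x, ‖fderiv ℝ (fderiv ℝ G) x‖ ≤ C) : SmoothField b fun x => c • x + e • G x := by
  have hd : Differentiable ℝ G := hG.differentiable (by norm_num)
  refine ⟨by fun_prop, fun i => ?_⟩
  simp only [inner_add_left, real_inner_smul_left]
  exact ((SmoothPG.inner_right (b i)).const_mul c).add
    ((smoothPG_inner hG hL hC (b i)).const_mul e)

lemma fderiv_affine (hG : ContDiff ℝ 2 G) (x : E) : fderiv ℝ (fun x => c • x + e • G x) x =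
    c • ContinuousLinearMap.id ℝ E + e • fderiv ℝ G x := by
  have hd : Differentiable ℝ G := hG.differentiable (by norm_num)
  exact (((hasFDerivAt_id x).const_smul c).add ((hd x).hasFDerivAt.const_smul e)).fderiv

lemma gradient_jetQuad (hG : ContDiff ℝ 2 G) (x : E) :
    ∇ (fun x => jetQuad α β (jet G x)) x =
      (2 * α) • (fderiv ℝ G x).adjoint (G x) + β • (G x + (fderiv ℝ G x).adjoint x) := by
  have hd : Differentiable ℝ G := hG.differentiable (by norm_num)
  refine HasGradientAt.gradient (hasGradientAt_iff_hasFDerivAt.2 ?_)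
  have h1 := ((hd x).hasFDerivAt.norm_sq.const_mul α).add
    (((hasFDerivAt_id x).inner ℝ (hd x).hasFDerivAt).const_mul β)
  refine h1.congr_fderiv ?_
  ext v
  simp only [InnerProductSpace.toDual_apply_apply, ContinuousLinearMap.adjoint_inner_left,
    inner_add_left, real_inner_smul_left]
  simp [real_inner_comm v]
  ring

lemma smooth_variance_le (hG : ContDiff ℝ 2 G) (hL : LipschitzWith K G) {C : ℝ}
    (hC : ∀ x, ‖fderiv ℝ (fderiv ℝ G) x‖ ≤ C) :
    ∫ x, (jetQuad α β (jet G x) + jetDiv b c e (jet G x)) ^ 2 ∂(stdGaussian E) -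
      (∫ x, jetQuad α β (jet G x) ∂(stdGaussian E)) ^ 2 ≤
      ∫ x, jetBound b α β c e (jet G x) ∂(stdGaussian E) := by
  have hd : Differentiable ℝ G := hG.differentiable (by norm_num)
  have pb : PolyGrowth (fderiv ℝ G) :=
    PolyGrowth.of_bounded fun _ => norm_fderiv_le_of_lipschitz ℝ hL
  have hQ : ContDiff ℝ 1 fun x => jetQuad α β (jet G x) := by
    have : ContDiff ℝ 1 G := hG.of_le (by norm_num)
    exact (contDiff_const.mul (this.norm_sq ℝ)).add (contDiff_const.mul (contDiff_id.inner ℝ this))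
  have hp : PolyGrowth fun x => jetQuad α β (jet G x) :=
    polyGrowth_comp_jet hL (polyGrowth_jetQuad α β)
  have hp' : PolyGrowth (fderiv ℝ fun x => jetQuad α β (jet G x)) := by
    have pg : PolyGrowth (∇ fun x => jetQuad α β (jet G x)) := by
      rw [show (∇ fun x => jetQuad α β (jet G x)) = _ from funext (gradient_jetQuad hG)]
      have pa : PolyGrowth fun x => (fderiv ℝ G x).adjoint := pb.mono fun x => by simp
      have pG := PolyGrowth.of_lipschitz hL
      exact ((PolyGrowth.const _).smul (pa.clm_apply pG)).add
        ((PolyGrowth.const _).smul (pG.add (pa.clm_apply PolyGrowth.id)))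
    exact pg.mono fun x => (norm_gradient _ x).ge
  have := (smoothField_affine (b := b) (c := c) (e := e) hG hL hC).variance_le hQ hp hp'
  simp only [fderiv_affine hG, gradient_jetQuad hG] at this
  exact this

lemma smooth_integral_div (hG : ContDiff ℝ 2 G) (hL : LipschitzWith K G) {C : ℝ}
    (hC : ∀ x, ‖fderiv ℝ (fderiv ℝ G) x‖ ≤ C) :
    ∫ x, jetDiv b c e (jet G x) ∂(stdGaussian E) = 0 := by
  have := (smoothField_affine (b := b) (c := c) (e := e) hG hL hC).integral_div
  simp only [fderiv_affine hG] at this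
  exact this

end Smooth

variable {g : E → E}

/-- **Stein's identity** for Lipschitz vector fields. -/
theorem integral_jetDiv (hg : LipschitzWith K g) :
    ∫ x, jetDiv b c e (jet g x) ∂(stdGaussian E) = 0 := by
  obtain ⟨G, h1, h2, h3, h4, h5, h6⟩ := exists_smooth_approx hg
  have ht := tendsto_integral_jet hg h2 h4 h5 h6 (continuous_jetDiv b c e) (polyGrowth_jetDiv b c e)
  refine tendsto_nhds_unique ht ?_
  have : ∀ k, ∫ x, jetDiv b c e (jet (G k) x) ∂(stdGaussian E) = 0 := fun k => by
    obtain ⟨C, hC⟩ := h3 k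
    exact smooth_integral_div (h1 k) (h2 k) hC
  simp only [this]
  exact tendsto_const_nhds

/-- The second order Poincaré inequality for Lipschitz vector fields. -/
theorem integral_sub_sq_le_jetBound (hg : LipschitzWith K g) :
    ∫ x, (jetQuad α β (jet g x) + jetDiv b c e (jet g x) -
        ∫ z, jetQuad α β (jet g z) ∂(stdGaussian E)) ^ 2 ∂(stdGaussian E) ≤
      ∫ x, jetBound b α β c e (jet g x) ∂(stdGaussian E) := by
  obtain ⟨G, h1, h2, h3, h4, h5, h6⟩ := exists_smooth_approx hg
  have cQ := continuous_jetQuad (E := E) α β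
  have cD := continuous_jetDiv b c e
  have pQ := polyGrowth_jetQuad (E := E) α β
  have pD := polyGrowth_jetDiv b c e
  have t1 := tendsto_integral_jet hg h2 h4 h5 h6 
    (Φ := fun p => (jetQuad α β p + jetDiv b c e p) ^ 2) ((cQ.add cD).pow 2) ((pQ.add pD).pow 2)
  have t2 := tendsto_integral_jet hg h2 h4 h5 h6 cQ pQ
  have t3 := tendsto_integral_jet hg h2 h4 h5 h6 (continuous_jetBound b α β c e)
    (polyGrowth_jetBound b α β c e)
  have key := le_of_tendsto_of_tendsto (t1.sub (t2.pow 2)) t3 (Eventually.of_forall fun k => by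
    obtain ⟨C, hC⟩ := h3 k
    exact smooth_variance_le (h1 k) (h2 k) hC)
  refine le_trans (le_of_eq ?_) key
  set m := ∫ z, jetQuad α β (jet g z) ∂(stdGaussian E) with hm
  have i1 := integrable_comp_jet hg (Φ := fun p => (jetQuad α β p + jetDiv b c e p) ^ 2)
    ((cQ.add cD).pow 2) ((pQ.add pD).pow 2)
  have iQ := integrable_comp_jet hg cQ pQ
  have iD := integrable_comp_jet hg cD pD
  have e1 : ∀ x, (jetQuad α β (jet g x) + jetDiv b c e (jet g x) - m) ^ 2 =
      (jetQuad α β (jet g x) + jetDiv b c e (jet g x)) ^ 2 +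
        (-(2 * m) * (jetQuad α β (jet g x) + jetDiv b c e (jet g x)) + m ^ 2) := fun x => by ring
  simp only [e1]
  have i2 : Integrable (fun x => -(2 * m) * (jetQuad α β (jet g x) + jetDiv b c e (jet g x)))
      (stdGaussian E) := (iQ.add iD).const_mul _
  have i3 : Integrable (fun x => -(2 * m) * (jetQuad α β (jet g x) + jetDiv b c e (jet g x))
      + m ^ 2) (stdGaussian E) := i2.add (integrable_const _)
  -- Since the divergence has mean zero, `m` is also the mean of `jetQuad + jetDiv`, and the centred
  -- second moment is a variance.
  rw [integral_add i1 i3, integral_add i2 (integrable_const _), integral_const_mul,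
    integral_add iQ iD, integral_jetDiv b c e hg, ← hm]
  simp
  ring

end Lipschitz

/-! ### Operators with `0 ≤ A ≤ 1` and the three variance bounds. -/

section Positive

set_option linter.unusedSectionVars false

variable {E : Type*} [NormedAddCommGroup E] [InnerProductSpace ℝ E] [FiniteDimensional ℝ E]
  [MeasurableSpace E] [BorelSpace E] {ι : Type*} [Fintype ι] {A : E →L[ℝ] E}

/-- This is `A² ≤ A`. Expand `0 ≤ ⟪A(x - Ax), x - Ax⟫ = ⟪Ax, x⟫ - 2‖Ax‖² + ⟪A(Ax), Ax⟫` and bound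
the last term by `‖Ax‖²`. -/
lemma norm_sq_le_inner_of_isPositive (hA : A.IsPositive) (h1 : ‖A‖ ≤ 1) (x : E) :
    ‖A x‖ ^ 2 ≤ ⟪A x, x⟫ := by
  have h := hA.inner_nonneg_left (x - A x)
  have s : ⟪A (A x), x⟫ = ‖A x‖ ^ 2 := by
    rw [← real_inner_self_eq_norm_sq]; exact hA.isSymmetric (A x) x
  have h2 : ⟪A (A x), A x⟫ ≤ ‖A x‖ ^ 2 := by
    refine (real_inner_le_norm _ _).trans ?_
    rw [sq]
    gcongr
    exact (A.le_opNorm _).trans (mul_le_of_le_one_left (norm_nonneg _) h1)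
  simp only [map_sub, inner_sub_left, inner_sub_right, s, real_inner_self_eq_norm_sq] at h
  linarith

lemma norm_sub_sq_le_of_isPositive (hA : A.IsPositive) (h1 : ‖A‖ ≤ 1) (x : E) :
    ‖x - A x‖ ^ 2 ≤ ‖x‖ ^ 2 := by
  have h := norm_sq_le_inner_of_isPositive hA h1 x
  have h2 := hA.inner_nonneg_left x
  rw [norm_sub_sq_real, real_inner_comm]
  linarith

/-- Symmetry identifies `tr(B²)` with the squared Hilbert–Schmidt norm, which can be bounded one
basis vector at a time. -/
lemma basisTraceSq_of_isSymmetric (b : OrthonormalBasis ι ℝ E) {B : E →L[ℝ] E}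
    (hB : B.toLinearMap.IsSymmetric) : basisTraceSq b B = ∑ i, ‖B (b i)‖ ^ 2 := by
  refine Finset.sum_congr rfl fun i _ => ?_
  rw [← real_inner_self_eq_norm_sq, ← b.sum_inner_mul_inner (B (b i)) (B (b i))]
  exact Finset.sum_congr rfl fun j _ => congrArg _ (hB (b j) (b i))

lemma isSymmetric_affine (hA : A.IsPositive) (c e : ℝ) :
    (c • ContinuousLinearMap.id ℝ E + e • A).toLinearMap.IsSymmetric := fun x y => by
  have := hA.isSymmetric x y
  simp only [ContinuousLinearMap.coe_coe] at this
  simp [inner_add_left, inner_add_right, real_inner_smul_left, real_inner_smul_right, this]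

lemma basisTraceSq_smul_le (b : OrthonormalBasis ι ℝ E) (hA : A.IsPositive) (h1 : ‖A‖ ≤ 1)
    (e : ℝ) : basisTraceSq b ((0 : ℝ) • ContinuousLinearMap.id ℝ E + e • A) ≤
      e ^ 2 * basisTrace b A := by
  rw [basisTraceSq_of_isSymmetric b (isSymmetric_affine hA 0 e), basisTrace, Finset.mul_sum]
  refine Finset.sum_le_sum fun i _ => ?_
  simp only [zero_smul, zero_add, _root_.smul_apply, norm_smul, mul_pow, Real.norm_eq_abs, sq_abs]
  gcongr
  exact norm_sq_le_inner_of_isPositive hA h1 _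

lemma basisTraceSq_id_sub_le (b : OrthonormalBasis ι ℝ E) (hA : A.IsPositive) (h1 : ‖A‖ ≤ 1) :
    basisTraceSq b ((1 : ℝ) • ContinuousLinearMap.id ℝ E + (-1 : ℝ) • A) ≤ Fintype.card ι := by
  rw [basisTraceSq_of_isSymmetric b (isSymmetric_affine hA 1 (-1))]
  have : ∀ i ∈ Finset.univ,
      ‖((1 : ℝ) • ContinuousLinearMap.id ℝ E + (-1 : ℝ) • A) (b i)‖ ^ 2 ≤ (1 : ℝ) := fun i _ => by
    have := norm_sub_sq_le_of_isPositive hA h1 (b i)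
    simpa [← sub_eq_add_neg] using this
  simpa using Finset.sum_le_sum this

lemma basisTrace_affine (b : OrthonormalBasis ι ℝ E) (c e : ℝ) :
    basisTrace b (c • ContinuousLinearMap.id ℝ E + e • A) =
      c * Fintype.card ι + e * basisTrace b A := by
  simp [basisTrace, inner_add_left, real_inner_smul_left, Finset.sum_add_distrib, Finset.mul_sum,
    mul_comm]

variable {g : E → E} (b : OrthonormalBasis ι ℝ E)

lemma integral_inner_sub_trace (hg : LipschitzWith 1 g) :
    ∫ x, (⟪x, g x⟫ - basisTrace b (fderiv ℝ g x)) ∂(stdGaussian E) = 0 := by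
  simpa [jetDiv, jet, basisTrace_affine] using integral_jetDiv b 0 1 hg

lemma integral_norm_sq_sub_card (hb : OrthonormalBasis ι ℝ E) :
    ∫ x : E, (‖x‖ ^ 2 - Fintype.card ι) ∂(stdGaussian E) = 0 := by
  have := integral_jetDiv hb 1 0 (K := 1) (g := fun x : E => x) LipschitzWith.id
  simp only [jetDiv, jet, basisTrace_affine] at this
  simpa only [one_smul, zero_smul, add_zero, one_mul, zero_mul,
    real_inner_self_eq_norm_sq] using this

lemma integral_norm_sq (hb : OrthonormalBasis ι ℝ E) :
    ∫ x : E, ‖x‖ ^ 2 ∂(stdGaussian E) = Fintype.card ι := by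
  have h := integral_norm_sq_sub_card hb
  have i : Integrable (fun x : E => ‖x‖ ^ 2) (stdGaussian E) :=
    (PolyGrowth.id.norm.pow 2).integrable _ (Continuous.aestronglyMeasurable (by fun_prop))
  rw [integral_sub i (integrable_const _)] at h
  simpa [sub_eq_zero] using h

variable {b}

lemma memLp_basisTrace_fderiv (b : OrthonormalBasis ι ℝ E) (hg : LipschitzWith 1 g) :
    MemLp (fun x => basisTrace b (fderiv ℝ g x)) 2 (stdGaussian E) := by
  have h := memLp_two_comp_jet hg (Φ := fun p => basisTrace b p.2.2)
    (by unfold basisTrace; fun_prop)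
    (PolyGrowth.sum _ fun i _ => (((PolyGrowth.snd.comp PolyGrowth.snd :
      PolyGrowth fun p : E × E × (E →L[ℝ] E) => p.2.2).clm_apply
        (PolyGrowth.const (b i))).inner (PolyGrowth.const (b i))))
  exact h

lemma memLp_norm_sq (hg : LipschitzWith 1 g) :
    MemLp (fun x => ‖g x‖ ^ 2) 2 (stdGaussian E) :=
  ((PolyGrowth.of_lipschitz hg).norm.pow 2).memLp_two _
    (hg.continuous.norm.pow 2).aestronglyMeasurable

lemma ae_norm_fderiv_le (hg : LipschitzWith 1 g) (x : E) : ‖fderiv ℝ g x‖ ≤ 1 := by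
  simpa using norm_fderiv_le_of_lipschitz ℝ hg

/-- Variance bound for the Stein unbiased risk estimate, centred at the risk. -/
theorem integral_risk_sq_le (hg : LipschitzWith 1 g)
    (hpos : ∀ᵐ x ∂(stdGaussian E), (fderiv ℝ g x).IsPositive) :
    ∫ x, (‖g x‖ ^ 2 - ∫ z, ‖g z‖ ^ 2 ∂(stdGaussian E)
        - 2 * (⟪x, g x⟫ - basisTrace b (fderiv ℝ g x))) ^ 2 ∂(stdGaussian E) ≤
      4 * ∫ x, (‖g x‖ ^ 2 + basisTrace b (fderiv ℝ g x)) ∂(stdGaussian E) := by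
  -- The choice `Q = ‖g‖²`, `F = -2g`.
  have h := integral_sub_sq_le_jetBound b 1 0 0 (-2) hg
  rw [← integral_const_mul]
  have e : ∀ x, (jetQuad 1 0 (jet g x) + jetDiv b 0 (-2) (jet g x) -
      ∫ z, jetQuad 1 0 (jet g z) ∂(stdGaussian E)) ^ 2 =
      (‖g x‖ ^ 2 - ∫ z, ‖g z‖ ^ 2 ∂(stdGaussian E)
        - 2 * (⟪x, g x⟫ - basisTrace b (fderiv ℝ g x))) ^ 2 := fun x => by
    simp only [jetQuad, jetDiv, jet, basisTrace_affine, inner_add_right, real_inner_smul_right,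
      one_mul, zero_mul, add_zero]
    ring
  simp only [e] at h
  refine h.trans (integral_mono_ae (integrable_comp_jet hg (continuous_jetBound b 1 0 0 (-2))
    (polyGrowth_jetBound b 1 0 0 (-2))) (((memLp_norm_sq hg).integrable (by norm_num)).add
      ((memLp_basisTrace_fderiv b hg).integrable (by norm_num)) |>.const_mul 4) ?_)
  filter_upwards [hpos] with x hx
  have h1 := ae_norm_fderiv_le hg x
  have n1 := norm_sub_sq_le_of_isPositive hx h1 (g x)
  have n2 := basisTraceSq_smul_le b hx h1 (-2)
  -- Self-adjointness turns `∇Q + F = 2A*g - 2g` into `-2(1 - A)g`, of norm at most `2‖g‖`.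
  have e2 : (2 * (1 : ℝ)) • (fderiv ℝ g x).adjoint (g x) +
      (0 : ℝ) • (g x + (fderiv ℝ g x).adjoint x) + ((0 : ℝ) • x + (-2 : ℝ) • g x) =
      (-2 : ℝ) • (g x - fderiv ℝ g x (g x)) := by
    rw [hx.isSelfAdjoint.adjoint_eq]; module
  simp only [jetBound, jet, e2, norm_smul, mul_pow]
  norm_num at n2 ⊢
  linarith

/-- Variance bound for the Stein unbiased risk estimate, centred at the loss. -/
theorem integral_loss_sq_le (hg : LipschitzWith 1 g)
    (hpos : ∀ᵐ x ∂(stdGaussian E), (fderiv ℝ g x).IsPositive) :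
    ∫ x, (-2 * (⟪x, g x⟫ - basisTrace b (fderiv ℝ g x))) ^ 2 ∂(stdGaussian E) ≤
      4 * ∫ x, (‖g x‖ ^ 2 + basisTrace b (fderiv ℝ g x)) ∂(stdGaussian E) := by
  -- The choice `Q = 0`, `F = -2g`: centring at the loss removes `‖g‖²`.
  have h := integral_sub_sq_le_jetBound b 0 0 0 (-2) hg
  rw [← integral_const_mul]
  have e : ∀ x, (jetQuad 0 0 (jet g x) + jetDiv b 0 (-2) (jet g x) -
      ∫ z, jetQuad 0 0 (jet g z) ∂(stdGaussian E)) ^ 2 =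
      (-2 * (⟪x, g x⟫ - basisTrace b (fderiv ℝ g x))) ^ 2 := fun x => by
    simp only [jetQuad, jetDiv, jet, basisTrace_affine, inner_add_right, real_inner_smul_right,
      zero_mul, add_zero, integral_zero]
    ring
  simp only [e] at h
  refine h.trans (integral_mono_ae (integrable_comp_jet hg (continuous_jetBound b 0 0 0 (-2))
    (polyGrowth_jetBound b 0 0 0 (-2))) (((memLp_norm_sq hg).integrable (by norm_num)).add
      ((memLp_basisTrace_fderiv b hg).integrable (by norm_num)) |>.const_mul 4) ?_)
  filter_upwards [hpos] with x hx
  have n2 := basisTraceSq_smul_le b hx (ae_norm_fderiv_le hg x) (-2)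
  simp only [jetBound, jet, mul_zero, zero_smul, zero_add, norm_smul, mul_pow] at n2 ⊢
  norm_num at n2 ⊢
  linarith

/-- Variance bound for the degrees of freedom plus the squared norm of the noise. -/
theorem integral_norm_sq_add_trace_sq_le (hg : LipschitzWith 1 g)
    (hpos : ∀ᵐ x ∂(stdGaussian E), (fderiv ℝ g x).IsPositive) :
    ∫ x, (‖x‖ ^ 2 - Fintype.card ι + (basisTrace b (fderiv ℝ g x) -
        ∫ z, basisTrace b (fderiv ℝ g z) ∂(stdGaussian E))) ^ 2 ∂(stdGaussian E) ≤
      6 * Fintype.card ι := by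
  -- The choice `Q = ⟪x, g⟫`, `F = x - g`: the inner products cancel in `Q + δF = ‖x‖² - n + tr A`,
  -- and `∇Q + F = x + Ax` no longer involves `g`.
  have h := integral_sub_sq_le_jetBound b 0 1 1 (-1) hg
  have it := (memLp_basisTrace_fderiv b hg).integrable (by norm_num)
  have ii : Integrable (fun x => ⟪x, g x⟫) (stdGaussian E) :=
    (PolyGrowth.id.inner (PolyGrowth.of_lipschitz hg)).integrable _
      (continuous_id.inner hg.continuous).aestronglyMeasurable
  have hm : ∫ z, jetQuad 0 1 (jet g z) ∂(stdGaussian E) =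
      ∫ z, basisTrace b (fderiv ℝ g z) ∂(stdGaussian E) := by
    have := integral_inner_sub_trace b hg
    rw [integral_sub ii it, sub_eq_zero] at this
    simpa [jetQuad, jet] using this
  rw [hm] at h
  have e : ∀ x, (jetQuad 0 1 (jet g x) + jetDiv b 1 (-1) (jet g x) -
      ∫ z, basisTrace b (fderiv ℝ g z) ∂(stdGaussian E)) ^ 2 =
      (‖x‖ ^ 2 - Fintype.card ι + (basisTrace b (fderiv ℝ g x) -
        ∫ z, basisTrace b (fderiv ℝ g z) ∂(stdGaussian E))) ^ 2 := fun x => by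
    simp only [jetQuad, jetDiv, jet, basisTrace_affine, inner_add_right, real_inner_smul_right,
      zero_mul, real_inner_self_eq_norm_sq]
    ring
  simp only [e] at h
  have in2 : Integrable (fun x : E => ‖x‖ ^ 2) (stdGaussian E) :=
    (PolyGrowth.id.norm.pow 2).integrable _ (Continuous.aestronglyMeasurable (by fun_prop))
  have i3 : Integrable (fun x : E => 4 * ‖x‖ ^ 2 + Fintype.card ι) (stdGaussian E) :=
    (in2.const_mul 4).add (integrable_const _)
  calc _ ≤ _ := h
    _ ≤ ∫ x : E, (4 * ‖x‖ ^ 2 + Fintype.card ι) ∂(stdGaussian E) := by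
        refine integral_mono_ae (integrable_comp_jet hg (continuous_jetBound b 0 1 1 (-1))
          (polyGrowth_jetBound b 0 1 1 (-1))) i3 ?_
        filter_upwards [hpos] with x hx
        have h1 := ae_norm_fderiv_le hg x
        have n2 := basisTraceSq_id_sub_le b hx h1
        have e2 : (2 * (0 : ℝ)) • (fderiv ℝ g x).adjoint (g x) +
            (1 : ℝ) • (g x + (fderiv ℝ g x).adjoint x) + ((1 : ℝ) • x + (-1 : ℝ) • g x) =
            x + fderiv ℝ g x x := by
          rw [hx.isSelfAdjoint.adjoint_eq]; module
        simp only [jetBound, jet, e2]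
        have n3 : ‖x + fderiv ℝ g x x‖ ≤ 2 * ‖x‖ := by
          refine (norm_add_le _ _).trans ?_
          have := ((fderiv ℝ g x).le_opNorm x).trans
            (mul_le_of_le_one_left (norm_nonneg x) h1)
          linarith
        have n4 : ‖x + fderiv ℝ g x x‖ ^ 2 ≤ (2 * ‖x‖) ^ 2 := by gcongr
        linarith [mul_pow 2 ‖x‖ 2]
    -- `4n` comes from `‖x + Ax‖² ≤ 4‖x‖²` and `n` from `tr((1 - A)²)`; the final bound `6n` has
    -- slack.
    _ = 5 * Fintype.card ι := by
        rw [integral_add (in2.const_mul 4) (integrable_const _), integral_const_mul,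
          integral_norm_sq b]
        simp
        ring
    _ ≤ _ := by
        have : (0 : ℝ) ≤ Fintype.card ι := Nat.cast_nonneg _
        linarith

end Positive

/-! ### From moment bounds to data-driven bounds and confidence statements. -/

section Probability

set_option linter.unusedSectionVars false

variable {Ω : Type*} [MeasurableSpace Ω] {P : Measure Ω} [IsProbabilityMeasure P]

/-- `X` is `|Z|` divided by its `L²` norm, built from a measurable representative. If the norm
vanishes, `X = 1` works because `Z = 0` almost surely. -/
lemma exists_normalized {Z : Ω → ℝ} (hZ : MemLp Z 2 P) :
    ∃ X : Ω → ℝ, Measurable X ∧ (∀ ω, 0 ≤ X ω) ∧ ∫ ω, X ω ^ 2 ∂P = 1 ∧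
      ∀ᵐ ω ∂P, |Z ω| = X ω * √(∫ ω, Z ω ^ 2 ∂P) := by
  have hm := hZ.aestronglyMeasurable.aemeasurable
  have hnn : 0 ≤ ∫ ω, Z ω ^ 2 ∂P := integral_nonneg fun ω => sq_nonneg _
  rcases hnn.eq_or_lt with h0 | h0
  · refine ⟨fun _ => 1, measurable_const, fun _ => zero_le_one, by simp, ?_⟩
    have := (integral_eq_zero_iff_of_nonneg (fun ω => sq_nonneg (Z ω)) hZ.integrable_sq).1 h0.symm
    filter_upwards [this] with ω hω
    have : Z ω = 0 := by simpa using hω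
    simp [← h0, this]
  · set s := √(∫ ω, Z ω ^ 2 ∂P) with hs
    have hs0 : 0 < s := Real.sqrt_pos.2 h0
    have hs2 : s ^ 2 = ∫ ω, Z ω ^ 2 ∂P := Real.sq_sqrt hnn
    refine ⟨fun ω => |hm.mk Z ω| / s, (hm.measurable_mk.abs).div_const s, fun ω => by positivity,
      ?_, ?_⟩
    · have : ∫ ω, (|hm.mk Z ω| / s) ^ 2 ∂P = ∫ ω, Z ω ^ 2 / s ^ 2 ∂P := by
        refine integral_congr_ae ?_
        filter_upwards [hm.ae_eq_mk] with ω hω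
        rw [← hω, div_pow, sq_abs]
      rw [this, integral_div, ← hs2, div_self (by positivity)]
    · filter_upwards [hm.ae_eq_mk] with ω hω
      rw [← hω, div_mul_cancel₀ _ hs0.ne']

/-- Minkowski in `L²`, from `(W + V)² ≤ (1 + b/a) W² + (1 + a/b) V²`. These weights turn the bounds
`a²`, `b²` into exactly `(a + b)²`; they need `a ≠ 0`, hence the separate case. -/
lemma sqrt_integral_add_sq_le {W V : Ω → ℝ} (hW : MemLp W 2 P) (hV : MemLp V 2 P) {a b : ℝ}
    (ha : 0 ≤ a) (hb : 0 < b) (hWa : ∫ ω, W ω ^ 2 ∂P ≤ a ^ 2) (hVb : ∫ ω, V ω ^ 2 ∂P ≤ b ^ 2) :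
    √(∫ ω, (W ω + V ω) ^ 2 ∂P) ≤ a + b := by
  rw [Real.sqrt_le_left (by positivity)]
  rcases ha.eq_or_lt with rfl | ha
  · have h0 : ∫ ω, W ω ^ 2 ∂P = 0 :=
      le_antisymm (by simpa using hWa) (integral_nonneg fun ω => sq_nonneg _)
    have h1 := (integral_eq_zero_iff_of_nonneg (fun ω => sq_nonneg (W ω)) hW.integrable_sq).1 h0
    have : ∫ ω, (W ω + V ω) ^ 2 ∂P = ∫ ω, V ω ^ 2 ∂P := by
      refine integral_congr_ae ?_
      filter_upwards [h1] with ω hω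
      have : W ω = 0 := by simpa using hω
      simp [this]
    simpa [this] using hVb
  · have h1 : Integrable (fun ω => (1 + b / a) * W ω ^ 2) P := hW.integrable_sq.const_mul _
    have h2 : Integrable (fun ω => (1 + a / b) * V ω ^ 2) P := hV.integrable_sq.const_mul _
    calc ∫ ω, (W ω + V ω) ^ 2 ∂P
        ≤ ∫ ω, ((1 + b / a) * W ω ^ 2 + (1 + a / b) * V ω ^ 2) ∂P := by
          refine integral_mono (hW.add hV).integrable_sq (h1.add h2) fun ω => ?_
          have : (1 + b / a) * W ω ^ 2 + (1 + a / b) * V ω ^ 2 - (W ω + V ω) ^ 2 =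
              (b * W ω - a * V ω) ^ 2 / (a * b) := by
            field_simp
            ring
          have h3 : 0 ≤ (b * W ω - a * V ω) ^ 2 / (a * b) := by positivity
          dsimp only
          linarith
      _ = (1 + b / a) * ∫ ω, W ω ^ 2 ∂P + (1 + a / b) * ∫ ω, V ω ^ 2 ∂P := by
          rw [integral_add h1 h2, integral_const_mul, integral_const_mul]
      _ ≤ (1 + b / a) * a ^ 2 + (1 + a / b) * b ^ 2 := by gcongr
      _ = (a + b) ^ 2 := by
          field_simp
          ring

/-- With `r = √(4m/n)` and `p = Y/√n` the hypotheses give `r² ≤ w² + 4pr + q²`. Completing the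
square yields `(r - 2p)² ≤ (w + 2p + q)²`, hence `r ≤ w + 4p + q`. -/
lemma sqrt_le_of_deviation {n t m Y s : ℝ} (hn : 0 < n) (hm : 0 ≤ m) (hY : 0 ≤ Y)
    (hd : |t - m| = Y * s) (hs : s ≤ √(4 * m) + √(6 * n)) :
    √(4 * m / n) ≤ √(4 * max (t / n) 0) + 4 * Y / √n + √(4 * Y) * (6 / n) ^ (1 / 4 : ℝ) := by
  set r := √(4 * m / n)
  set w := √(4 * max (t / n) 0)
  set p := Y / √n with hp
  set q := √(4 * Y) * (6 / n) ^ (1 / 4 : ℝ) with hq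
  have hn' : 0 < √n := Real.sqrt_pos.2 hn
  have hp0 : 0 ≤ p := by positivity
  have hq0 : 0 ≤ q := by positivity
  have hr0 : 0 ≤ r := Real.sqrt_nonneg _
  have hw0 : 0 ≤ w := Real.sqrt_nonneg _
  have hr : r ^ 2 = 4 * m / n := Real.sq_sqrt (by positivity)
  have hw : w ^ 2 = 4 * max (t / n) 0 := Real.sq_sqrt (by positivity)
  have hnn : √n * √n = n := Real.mul_self_sqrt hn.le
  have hq2 : q ^ 2 = 4 * Y * (√6 / √n) := by
    rw [hq, mul_pow, Real.sq_sqrt (by positivity), ← Real.rpow_natCast, ← Real.rpow_mul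
      (by positivity), ← Real.sqrt_div (by norm_num), Real.sqrt_eq_rpow]
    norm_num
  have h4m : √(4 * m) = √n * r := by
    rw [← Real.sqrt_mul hn.le]
    congr 1
    field_simp
  rw [h4m, Real.sqrt_mul (by norm_num)] at hs
  have h1 : 4 * m / n ≤ w ^ 2 + 4 * (Y * s) / n := by
    have h2 : m ≤ t + Y * s := by
      have := neg_abs_le (t - m)
      linarith
    have h3 : t / n ≤ max (t / n) 0 := le_max_left _ _
    rw [hw]
    calc 4 * m / n ≤ 4 * (t + Y * s) / n := by gcongr
      _ = 4 * (t / n) + 4 * (Y * s) / n := by ring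
      _ ≤ _ := by linarith
  have h2 : 4 * (Y * s) / n ≤ 4 * p * r + q ^ 2 := by
    calc 4 * (Y * s) / n ≤ 4 * (Y * (√n * r + √6 * √n)) / n := by gcongr
      _ = 4 * p * r + q ^ 2 := by
        rw [hq2, hp]
        conv_lhs => rw [← hnn]
        field_simp
        rw [Real.sqrt_sq hn'.le]
  have h3 : r ^ 2 ≤ w ^ 2 + 4 * p * r + q ^ 2 := by rw [hr]; linarith
  have h4 : (r - 2 * p) ^ 2 ≤ (w + 2 * p + q) ^ 2 := by
    nlinarith [mul_nonneg hw0 hp0, mul_nonneg hw0 hq0, mul_nonneg hp0 hq0]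
  have h5 := (abs_le_of_sq_le_sq' h4 (by positivity)).2
  have : 4 * Y / √n = 4 * p := by rw [hp]; ring
  rw [this]
  linarith

/-- The data-driven bound for a variable `W` with second moment at most `4 E T`. -/
lemma exists_data_driven_bound {n : ℝ} (hn : 0 < n) {T W : Ω → ℝ} (hT : MemLp T 2 P)
    (hW : MemLp W 2 P) (hWT : ∫ ω, W ω ^ 2 ∂P ≤ 4 * ∫ ω, T ω ∂P)
    (hsd : √(∫ ω, (T ω - ∫ ω', T ω' ∂P) ^ 2 ∂P) ≤ √(4 * ∫ ω, T ω ∂P) + √(6 * n)) :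
    ∃ X Y : Ω → ℝ, Measurable X ∧ Measurable Y ∧ (∀ ω, 0 ≤ X ω) ∧ (∀ ω, 0 ≤ Y ω) ∧
      ∫ ω, X ω ^ 2 ∂P = 1 ∧ ∫ ω, Y ω ^ 2 ∂P = 1 ∧
      ∀ᵐ ω ∂P, |W ω| / √n ≤ X ω * (√(4 * max (T ω / n) 0) + 4 * Y ω / √n
              + √(4 * Y ω) * (6 / n) ^ (1 / 4 : ℝ)) := by
  obtain ⟨X, hXm, hX0, hX1, hX⟩ := exists_normalized hW
  obtain ⟨Y, hYm, hY0, hY1, hY⟩ := exists_normalized (hT.sub (memLp_const (∫ ω', T ω' ∂P)))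
  refine ⟨X, Y, hXm, hYm, hX0, hY0, hX1, hY1, ?_⟩
  have hm : 0 ≤ ∫ ω, T ω ∂P := by
    have : 0 ≤ ∫ ω, W ω ^ 2 ∂P := integral_nonneg fun ω => sq_nonneg _
    linarith
  filter_upwards [hX, hY] with ω h1 h2
  have h3 := sqrt_le_of_deviation hn hm (hY0 ω) h2 hsd
  calc |W ω| / √n = X ω * √(∫ ω, W ω ^ 2 ∂P) / √n := by rw [h1]
    _ ≤ X ω * √(4 * ∫ ω, T ω ∂P) / √n := by
        have := hX0 ω
        gcongr
    _ = X ω * √(4 * (∫ ω, T ω ∂P) / n) := by rw [Real.sqrt_div (by positivity), mul_div_assoc]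
    _ ≤ _ := mul_le_mul_of_nonneg_left h3 (hX0 ω)

lemma measureReal_inv_lt_sq_le {X : Ω → ℝ} (hX1 : ∫ ω, X ω ^ 2 ∂P = 1) {β : ℝ} (hβ : 0 < β) :
    P.real {ω | β⁻¹ < X ω ^ 2} ≤ β := by
  have hi : Integrable (fun ω => X ω ^ 2) P := by
    -- A non-integrable function would have integral `0`, not `1`.
    by_contra h
    simp [integral_undef h] at hX1
  have h := mul_meas_ge_le_integral_of_nonneg (ae_of_all _ fun ω => sq_nonneg (X ω)) hi β⁻¹
  rw [hX1, inv_mul_le_iff₀ hβ, mul_one] at h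
  exact le_trans (measureReal_mono fun ω (hω : β⁻¹ < X ω ^ 2) => hω.le) h

lemma kappa_bound {n : ℕ} (hn : 0 < n) {β Y : ℝ} (hβ : 0 < β) (hY : Y ^ 2 ≤ β⁻¹) :
    4 * Y / √n + √(4 * Y) * (6 / n) ^ (1 / 4 : ℝ) ≤ kappa n β := by
  have hn' : (0 : ℝ) < n := Nat.cast_pos.2 hn
  have h1 : Y ≤ √(β⁻¹) := Real.le_sqrt_of_sq_le hY
  have h2 : √(4 * Y) = 2 * √Y := by
    rw [Real.sqrt_mul (by norm_num), show (4 : ℝ) = 2 ^ 2 by norm_num, Real.sqrt_sq (by norm_num)]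
  have h3 : √Y ≤ (β⁻¹) ^ (1 / 4 : ℝ) := by
    refine (Real.sqrt_le_sqrt h1).trans (le_of_eq ?_)
    rw [Real.sqrt_eq_rpow, Real.sqrt_eq_rpow, ← Real.rpow_mul (by positivity)]
    norm_num
  have h4 : (6 / (β * n)) ^ (1 / 4 : ℝ) = (β⁻¹) ^ (1 / 4 : ℝ) * (6 / n) ^ (1 / 4 : ℝ) := by
    rw [← Real.mul_rpow (by positivity) (by positivity)]
    congr 1
    field_simp
  rw [kappa, h2, h4, add_comm, Real.sqrt_mul hβ.le]
  refine add_le_add ?_ ?_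
  · rw [← mul_assoc]
    gcongr
  · rw [← div_div]
    gcongr
    rw [Real.sqrt_inv] at h1
    rw [div_eq_mul_inv]
    gcongr

/-- From a data-driven bound on `W` to a confidence statement on `U`. -/
lemma le_measureReal_of_data_driven_bound {n : ℕ} (hn : 0 < n) {U W Q Γ X Y : Ω → ℝ}
    (hY0 : ∀ ω, 0 ≤ Y ω) (hX1 : ∫ ω, X ω ^ 2 ∂P = 1)
    (hY1 : ∫ ω, Y ω ^ 2 ∂P = 1) (hΓ : ∀ ω, 0 ≤ Γ ω)
    (hW : ∀ᵐ ω ∂P, |W ω| / √n ≤ X ω * (Γ ω + 4 * Y ω / √n + √(4 * Y ω) * (6 / n) ^ (1 / 4 : ℝ)))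
    (hU : ∀ ω, |U ω| ≤ |W ω| + |Q ω|) {α β₁ β₂ δ v : ℝ} (hβ₁ : 0 < β₁) (hβ₂ : 0 < β₂)
    (hδ : α + β₁ + β₂ = δ) (hQ : P.real {ω | v < |Q ω| / √(2 * n)} ≤ α) :
    1 - δ ≤ P.real {ω | |U ω| / √(2 * n) ≤ v + (Γ ω + kappa n β₂) / √(2 * β₁)} := by
  have hn' : (0 : ℝ) < n := Nat.cast_pos.2 hn
  set A := {ω | |U ω| / √(2 * n) ≤ v + (Γ ω + kappa n β₂) / √(2 * β₁)}
  set N := {ω | ¬ |W ω| / √n ≤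
    X ω * (Γ ω + 4 * Y ω / √n + √(4 * Y ω) * (6 / n) ^ (1 / 4 : ℝ))} with hN
  have hN0 : P.real N = 0 := by
    rw [measureReal_def, show P N = 0 from ae_iff.1 hW, ENNReal.toReal_zero]
  -- Outside three bad events of mass at most `α`, `β₁`, `β₂` and a null set, the desired bound
  -- holds. Covering the whole space and using subadditivity avoids any measurability of `A`.
  have hcov : (Set.univ : Set Ω) ⊆ A ∪ ({ω | v < |Q ω| / √(2 * n)} ∪ ({ω | β₁⁻¹ < X ω ^ 2} ∪
      ({ω | β₂⁻¹ < Y ω ^ 2} ∪ N))) := by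
    intro ω _
    by_contra hω
    simp only [Set.mem_union, not_or] at hω
    obtain ⟨hA, h1, h2, h3, h4⟩ := hω
    replace h1 : |Q ω| / √(2 * n) ≤ v := not_lt.1 h1
    replace h2 : X ω ^ 2 ≤ β₁⁻¹ := not_lt.1 h2
    replace h3 : Y ω ^ 2 ≤ β₂⁻¹ := not_lt.1 h3
    replace h4 := not_not.1 h4
    apply hA
    change |U ω| / √(2 * n) ≤ v + (Γ ω + kappa n β₂) / √(2 * β₁)
    have hk := kappa_bound hn hβ₂ h3
    have hX : X ω ≤ (√β₁)⁻¹ := by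
      rw [← Real.sqrt_inv]; exact Real.le_sqrt_of_sq_le h2
    have h5 : |W ω| / √n ≤ (√β₁)⁻¹ * (Γ ω + kappa n β₂) := by
      refine h4.trans (mul_le_mul hX (by linarith) ?_ (by positivity))
      have := hΓ ω
      have := hY0 ω
      positivity
    have h6 : |W ω| / √(2 * n) ≤ (Γ ω + kappa n β₂) / √(2 * β₁) := by
      rw [Real.sqrt_mul (by norm_num), Real.sqrt_mul (by norm_num), mul_comm √2 √n, ← div_div,
        mul_comm √2 √β₁, ← div_div, div_eq_inv_mul (Γ ω + _)]
      gcongr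
    calc |U ω| / √(2 * n) ≤ (|W ω| + |Q ω|) / √(2 * n) := by
          have := hU ω
          gcongr
      _ ≤ _ := by rw [add_div]; linarith
  have h1 : (1 : ℝ) = P.real Set.univ := by simp
  have h2 := measureReal_mono (μ := P) hcov
  have h3 := measureReal_union_le (μ := P) A ({ω | v < |Q ω| / √(2 * n)} ∪ ({ω | β₁⁻¹ < X ω ^ 2} ∪
      ({ω | β₂⁻¹ < Y ω ^ 2} ∪ N)))
  have h4 := measureReal_union_le (μ := P) {ω | v < |Q ω| / √(2 * n)} ({ω | β₁⁻¹ < X ω ^ 2} ∪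
      ({ω | β₂⁻¹ < Y ω ^ 2} ∪ N))
  have h5 := measureReal_union_le (μ := P) {ω | β₁⁻¹ < X ω ^ 2} ({ω | β₂⁻¹ < Y ω ^ 2} ∪ N)
  have h6 := measureReal_union_le (μ := P) {ω | β₂⁻¹ < Y ω ^ 2} N
  have h7 := measureReal_inv_lt_sq_le hX1 hβ₁
  have h8 := measureReal_inv_lt_sq_le hY1 hβ₂
  linarith

end Probability

/-! ### Existence and uniqueness of the chi-square critical value. -/

section ChiSquare

variable {n : ℕ}

/-- The standardised deviation of `‖z‖²` from its mean `n`. -/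
noncomputable def normSqDev (z : EuclideanSpace ℝ (Fin n)) : ℝ := |‖z‖ ^ 2 - n| / √(2 * n)

lemma continuous_normSqDev : Continuous (normSqDev (n := n)) := by
  unfold normSqDev; fun_prop

lemma normSqDev_nonneg (z : EuclideanSpace ℝ (Fin n)) : 0 ≤ normSqDev z := by
  unfold normSqDev; positivity

variable (n) in
/-- The tail function of `|χ²_n - n| / √(2n)`. -/
noncomputable def chiTail (v : ℝ) : ℝ :=
  (stdGaussian (EuclideanSpace ℝ (Fin n))).real {z | v < normSqDev z}

lemma measurableSet_tail (v : ℝ) : MeasurableSet {z : EuclideanSpace ℝ (Fin n) | v < normSqDev z} :=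
  measurableSet_lt measurable_const continuous_normSqDev.measurable

lemma chiSquare_real_eq_chiTail (v : ℝ) :
    (chiSquare n).real {q | v < |q - n| / √(2 * n)} = chiTail n v := by
  have hm : Measurable fun z : EuclideanSpace ℝ (Fin n) => ‖z‖ ^ 2 := by fun_prop
  rw [chiSquare, map_measureReal_apply hm]
  · rfl
  · exact measurableSet_lt measurable_const (by fun_prop)

lemma chiTail_eq_integral (v : ℝ) : chiTail n v =
    ∫ z, {z | v < normSqDev z}.indicator (fun _ => (1 : ℝ)) z
      ∂(stdGaussian (EuclideanSpace ℝ (Fin n))) := by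
  rw [integral_indicator_const _ (measurableSet_tail v)]
  simp [chiTail]

/-- A level set lies in the union of two spheres, which are Lebesgue null in positive dimension.
Continuity of the tail follows. -/
lemma ae_normSqDev_ne (hn : 1 ≤ n) (v : ℝ) :
    ∀ᵐ z ∂(stdGaussian (EuclideanSpace ℝ (Fin n))), normSqDev z ≠ v := by
  have : Nonempty (Fin n) := ⟨⟨0, hn⟩⟩
  have hn' : (0 : ℝ) < n := Nat.cast_pos.2 hn
  have h0 : ∀ r : ℝ, ∀ᵐ z : EuclideanSpace ℝ (Fin n), z ∉ Metric.sphere 0 r := fun r => by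
    rw [ae_iff]
    exact measure_mono_null (fun z hz => not_not.1 hz)
      (Measure.addHaar_sphere (volume : Measure (EuclideanSpace ℝ (Fin n))) 0 r)
  refine stdGaussian_absolutelyContinuous.ae_le ?_
  filter_upwards [h0 √(n + v * √(2 * n)), h0 √(n - v * √(2 * n))] with z h1 h2 hz
  rw [normSqDev, div_eq_iff (by positivity)] at hz
  rw [mem_sphere_zero_iff_norm] at h1 h2
  rcases abs_choice (‖z‖ ^ 2 - n) with h | h
  · exact h1 (by rw [← hz, h, add_sub_cancel, Real.sqrt_sq (norm_nonneg z)])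
  · exact h2 (by rw [← hz, h, sub_neg_eq_add, add_sub_cancel, Real.sqrt_sq (norm_nonneg z)])

lemma continuous_chiTail (hn : 1 ≤ n) : Continuous (chiTail n) := by
  rw [continuous_iff_continuousAt]
  intro v
  rw [show chiTail n = _ from funext chiTail_eq_integral]
  refine continuousAt_of_dominated (bound := fun _ => 1) (Eventually.of_forall fun w => ?_)
    (Eventually.of_forall fun w => ae_of_all _ fun z => ?_) (integrable_const _) ?_
  · exact (measurable_const.indicator (measurableSet_tail w)).aestronglyMeasurable
  · refine (norm_indicator_le_norm_self _ _).trans (by simp)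
  · filter_upwards [ae_normSqDev_ne hn v] with z hz
    rcases hz.lt_or_gt with h | h
    · refine (continuousAt_const (y := (0 : ℝ))).congr ?_
      filter_upwards [lt_mem_nhds h] with w hw
      simp [Set.indicator, hw.le]
    · refine (continuousAt_const (y := (1 : ℝ))).congr ?_
      filter_upwards [gt_mem_nhds h] with w hw
      simp [Set.indicator, hw]

lemma tendsto_chiTail : Tendsto (chiTail n) atTop (𝓝 0) := by
  rw [show chiTail n = _ from funext chiTail_eq_integral]
  rw [← integral_zero (EuclideanSpace ℝ (Fin n)) ℝ
    (μ := stdGaussian (EuclideanSpace ℝ (Fin n)))]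
  refine tendsto_integral_filter_of_dominated_convergence (fun _ => 1)
    (Eventually.of_forall fun w => ?_) (Eventually.of_forall fun w => ae_of_all _ fun z => ?_)
    (integrable_const _) (ae_of_all _ fun z => ?_)
  · exact (measurable_const.indicator (measurableSet_tail w)).aestronglyMeasurable
  · refine (norm_indicator_le_norm_self _ _).trans (by simp)
  · refine tendsto_const_nhds.congr' ?_
    filter_upwards [eventually_ge_atTop (normSqDev z)] with w hw
    simp [Set.indicator, hw]

lemma chiTail_of_neg {v : ℝ} (hv : v < 0) : chiTail n v = 1 := by
  have : {z : EuclideanSpace ℝ (Fin n) | v < normSqDev z} = Set.univ :=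
    Set.eq_univ_of_forall fun z => hv.trans_le (normSqDev_nonneg z)
  simp [chiTail, this]

lemma chiTail_zero (hn : 1 ≤ n) : chiTail n 0 = 1 := by
  have : {z : EuclideanSpace ℝ (Fin n) | 0 < normSqDev z} =ᵐ[stdGaussian _] Set.univ := by
    filter_upwards [ae_normSqDev_ne hn 0] with z hz
    exact propext ⟨fun _ => trivial, fun _ => (normSqDev_nonneg z).lt_of_ne' hz⟩
  rw [chiTail, measureReal_congr this]
  simp

/-- For `0 ≤ v < w` the set where the deviation lies strictly between `v` and `w` is open and
nonempty, so it has positive Gaussian mass. -/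
lemma strictAntiOn_chiTail (hn : 1 ≤ n) : StrictAntiOn (chiTail n) (Set.Ici 0) := by
  intro v hv w _ hvw
  have : Nonempty (Fin n) := ⟨⟨0, hn⟩⟩
  have hn' : (0 : ℝ) < n := Nat.cast_pos.2 hn
  rw [Set.mem_Ici] at hv
  set U := {z : EuclideanSpace ℝ (Fin n) | v < normSqDev z ∧ normSqDev z < w}
  have hU : IsOpen U := (isOpen_lt continuous_const continuous_normSqDev).inter
    (isOpen_lt continuous_normSqDev continuous_const)
  have hne : U.Nonempty := by
    obtain ⟨z, hz⟩ := exists_norm_eq (EuclideanSpace ℝ (Fin n))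
      (Real.sqrt_nonneg (n + (v + w) / 2 * √(2 * n)))
    have h1 : normSqDev z = (v + w) / 2 := by
      have h2 : 0 ≤ (v + w) / 2 * √(2 * n) := by
        have : 0 ≤ (v + w) / 2 := by linarith
        positivity
      rw [normSqDev, hz, Real.sq_sqrt (by positivity), add_sub_cancel_left, abs_of_nonneg h2,
        mul_div_assoc, div_self (by positivity), mul_one]
    exact ⟨z, by rw [h1]; linarith, by rw [h1]; linarith⟩
  have hpos : 0 < (stdGaussian (EuclideanSpace ℝ (Fin n))).real U := by
    rw [measureReal_def, ENNReal.toReal_pos_iff]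
    refine ⟨pos_iff_ne_zero.2 fun h => ?_, measure_lt_top _ _⟩
    exact (hU.measure_pos volume hne).ne' (absolutelyContinuous_stdGaussian h)
  have hdisj : Disjoint U {z | w < normSqDev z} := by
    rw [Set.disjoint_left]
    exact fun z hz hz' => lt_asymm hz.2 hz'
  calc chiTail n w < (stdGaussian _).real U + chiTail n w := by linarith
    _ = (stdGaussian _).real (U ∪ {z | w < normSqDev z}) :=
        (measureReal_union hdisj (measurableSet_tail w)).symm
    _ ≤ chiTail n v := measureReal_mono (by
        rintro z (hz | hz)
        · exact hz.1
        · exact hvw.trans hz)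

theorem existsUnique_isChiSquareCritical (hn : 1 ≤ n) {α : ℝ} (h0 : 0 < α) (h1 : α < 1) :
    ∃! v : ℝ, IsChiSquareCritical n α v := by
  simp only [IsChiSquareCritical, chiSquare_real_eq_chiTail]
  obtain ⟨V, hV, hV0⟩ :=
    ((tendsto_chiTail (n := n)).eventually_lt_const h0 |>.and (eventually_ge_atTop 0)).exists
  have hiv := intermediate_value_Icc' hV0 (continuous_chiTail hn).continuousOn
  obtain ⟨v, hv, hva⟩ := hiv ⟨hV.le, by rw [chiTail_zero hn]; exact h1.le⟩
  refine ⟨v, hva, fun w (hw : chiTail n w = α) => ?_⟩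
  -- The tail is constantly `1` on negative arguments, so `α < 1` forces critical values into the
  -- range of strict monotonicity.
  have hw0 : 0 ≤ w := by
    by_contra h
    rw [chiTail_of_neg (not_le.1 h)] at hw
    exact h1.ne' hw
  exact (strictAntiOn_chiTail hn).injOn hw0 hv.1 (hw.trans hva.symm)

end ChiSquare

/-! ### SURE in normalised coordinates. -/

section Normalized

set_option linter.unusedSectionVars false

variable {E : Type*} [NormedAddCommGroup E] [InnerProductSpace ℝ E] [FiniteDimensional ℝ E]
  [MeasurableSpace E] [BorelSpace E] {ι : Type*} [Fintype ι]

/-- Stein's unbiased risk estimate for a standard Gaussian observation with mean zero. -/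
noncomputable def stdSure (b : OrthonormalBasis ι ℝ E) (g : E → E) (x : E) : ℝ :=
  ‖x - g x‖ ^ 2 + 2 * basisTrace b (fderiv ℝ g x) - Fintype.card ι

variable {b : OrthonormalBasis ι ℝ E} {g : E → E}

/-- Splits SURE into the loss, `-2 δg`, and a pure noise term; the last is what the `n - ‖x‖²`
correction removes. -/
lemma stdSure_eq (x : E) : stdSure b g x = ‖g x‖ ^ 2
    - 2 * (⟪x, g x⟫ - basisTrace b (fderiv ℝ g x)) + (‖x‖ ^ 2 - Fintype.card ι) := by
  rw [stdSure, norm_sub_sq_real]; ring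

lemma memLp_normSq (μ : Measure E) [IsGaussian μ] : MemLp (fun x : E => ‖x‖ ^ 2) 2 μ :=
  (PolyGrowth.id.norm.pow 2).memLp_two _ (Continuous.aestronglyMeasurable (by fun_prop))

lemma memLp_stdSure (hg : LipschitzWith 1 g) : MemLp (stdSure b g) 2 (stdGaussian E) := by
  have h1 : MemLp (fun x => ‖x - g x‖ ^ 2) 2 (stdGaussian E) :=
    ((PolyGrowth.id.sub (PolyGrowth.of_lipschitz hg)).norm.pow 2).memLp_two _
      ((continuous_id.sub hg.continuous).norm.pow 2).aestronglyMeasurable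
  exact (h1.add ((memLp_basisTrace_fderiv b hg).const_mul 2)).sub (memLp_const _)

lemma integral_stdSure (hg : LipschitzWith 1 g) :
    ∫ x, stdSure b g x ∂(stdGaussian E) = ∫ x, ‖g x‖ ^ 2 ∂(stdGaussian E) := by
  simp only [stdSure_eq]
  have i1 : Integrable (fun x => ‖g x‖ ^ 2) (stdGaussian E) :=
    (memLp_norm_sq hg).integrable (by norm_num)
  have i2 : Integrable (fun x => ⟪x, g x⟫ - basisTrace b (fderiv ℝ g x)) (stdGaussian E) :=
    ((PolyGrowth.id.inner (PolyGrowth.of_lipschitz hg)).integrable _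
      (continuous_id.inner hg.continuous).aestronglyMeasurable).sub
      ((memLp_basisTrace_fderiv b hg).integrable (by norm_num))
  have i3 : Integrable (fun x : E => ‖x‖ ^ 2 - (Fintype.card ι : ℝ)) (stdGaussian E) :=
    ((memLp_normSq _).integrable (by norm_num)).sub (integrable_const _)
  have i4 : Integrable (fun x => ‖g x‖ ^ 2 - 2 * (⟪x, g x⟫ - basisTrace b (fderiv ℝ g x)))
      (stdGaussian E) := i1.sub (i2.const_mul 2)
  rw [integral_add i4 i3, integral_sub i1 (i2.const_mul 2),
    integral_const_mul, integral_inner_sub_trace b hg, integral_norm_sq_sub_card b]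
  ring

lemma integral_stdSure_add_trace (hg : LipschitzWith 1 g) :
    ∫ x, (stdSure b g x + basisTrace b (fderiv ℝ g x)) ∂(stdGaussian E) =
      ∫ x, (‖g x‖ ^ 2 + basisTrace b (fderiv ℝ g x)) ∂(stdGaussian E) := by
  have it := (memLp_basisTrace_fderiv b hg).integrable (by norm_num)
  rw [integral_add ((memLp_stdSure hg).integrable (by norm_num)) it,
    integral_add ((memLp_norm_sq hg).integrable (by norm_num)) it, integral_stdSure hg]

lemma integral_stdSure_sub_risk_sq_le (hg : LipschitzWith 1 g)
    (hpos : ∀ᵐ x ∂(stdGaussian E), (fderiv ℝ g x).IsPositive) :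
    ∫ x, (stdSure b g x - ∫ z, ‖g z‖ ^ 2 ∂(stdGaussian E) + (Fintype.card ι - ‖x‖ ^ 2)) ^ 2
        ∂(stdGaussian E) ≤
      4 * ∫ x, (stdSure b g x + basisTrace b (fderiv ℝ g x)) ∂(stdGaussian E) := by
  rw [integral_stdSure_add_trace hg]
  refine le_trans (le_of_eq ?_) (integral_risk_sq_le (b := b) hg hpos)
  refine integral_congr_ae (ae_of_all _ fun x => ?_)
  simp only [stdSure_eq]
  ring

lemma integral_stdSure_sub_loss_sq_le (hg : LipschitzWith 1 g)
    (hpos : ∀ᵐ x ∂(stdGaussian E), (fderiv ℝ g x).IsPositive) :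
    ∫ x, (stdSure b g x - ‖g x‖ ^ 2 + (Fintype.card ι - ‖x‖ ^ 2)) ^ 2 ∂(stdGaussian E) ≤
      4 * ∫ x, (stdSure b g x + basisTrace b (fderiv ℝ g x)) ∂(stdGaussian E) := by
  rw [integral_stdSure_add_trace hg]
  refine le_trans (le_of_eq ?_) (integral_loss_sq_le (b := b) hg hpos)
  refine integral_congr_ae (ae_of_all _ fun x => ?_)
  simp only [stdSure_eq]
  ring

lemma memLp_risk (hg : LipschitzWith 1 g) (m : ℝ) :
    MemLp (fun x => stdSure b g x - m + (Fintype.card ι - ‖x‖ ^ 2)) 2 (stdGaussian E) :=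
  ((memLp_stdSure hg).sub (memLp_const m)).add ((memLp_const _).sub (memLp_normSq _))

lemma memLp_loss (hg : LipschitzWith 1 g) :
    MemLp (fun x => stdSure b g x - ‖g x‖ ^ 2 + (Fintype.card ι - ‖x‖ ^ 2)) 2 (stdGaussian E) :=
  ((memLp_stdSure hg).sub (memLp_norm_sq hg)).add ((memLp_const _).sub (memLp_normSq _))

/-- The centred variable is the risk-centred one plus `‖x‖² - n + (tr A - E tr A)`, the noise terms
cancelling. Minkowski combines their bounds `4 E T` and `6n`. -/
lemma sqrt_variance_stdSure_add_trace_le (hg : LipschitzWith 1 g)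
    (hpos : ∀ᵐ x ∂(stdGaussian E), (fderiv ℝ g x).IsPositive) (hι : 0 < Fintype.card ι) :
    √(∫ x, (stdSure b g x + basisTrace b (fderiv ℝ g x) -
        ∫ z, (stdSure b g z + basisTrace b (fderiv ℝ g z)) ∂(stdGaussian E)) ^ 2 ∂(stdGaussian E)) ≤
      √(4 * ∫ x, (stdSure b g x + basisTrace b (fderiv ℝ g x)) ∂(stdGaussian E)) +
        √(6 * Fintype.card ι) := by
  have hι' : (0 : ℝ) < Fintype.card ι := Nat.cast_pos.2 hι
  have it := memLp_basisTrace_fderiv b hg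
  set D := ∫ z, basisTrace b (fderiv ℝ g z) ∂(stdGaussian E) with hD
  set m := ∫ z, ‖g z‖ ^ 2 ∂(stdGaussian E) with hm
  have hV : MemLp (fun x => ‖x‖ ^ 2 - Fintype.card ι + (basisTrace b (fderiv ℝ g x) - D)) 2
      (stdGaussian E) :=
    ((memLp_normSq _).sub (memLp_const _)).add (it.sub (memLp_const D))
  have hW1 := integral_stdSure_sub_risk_sq_le (b := b) hg hpos
  have hnn : 0 ≤ 4 * ∫ x, (stdSure b g x + basisTrace b (fderiv ℝ g x)) ∂(stdGaussian E) :=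
    (integral_nonneg fun x => sq_nonneg _).trans hW1
  have h := sqrt_integral_add_sq_le (memLp_risk (b := b) hg m) hV
    (Real.sqrt_nonneg (4 * ∫ x, (stdSure b g x + basisTrace b (fderiv ℝ g x)) ∂(stdGaussian E)))
    (b := √(6 * Fintype.card ι)) (by positivity)
    (by rw [Real.sq_sqrt hnn]; exact hW1)
    (by rw [Real.sq_sqrt (by positivity)]; exact integral_norm_sq_add_trace_sq_le hg hpos)
  refine le_trans (le_of_eq ?_) h
  congr 1
  refine integral_congr_ae (ae_of_all _ fun x => ?_)
  simp only
  rw [integral_add ((memLp_stdSure hg).integrable (by norm_num)) (it.integrable (by norm_num)),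
    integral_stdSure hg, ← hm, ← hD]
  ring

end Normalized

/-! ### Change of variables to standard noise and zero mean. -/

section Transfer

variable {n : ℕ}

/-- `gradMatrix` has gradients as columns, so it is the transpose of the Jacobian; positive
semi-definiteness is unaffected. -/
lemma gradMatrix_eq_fderiv_apply (f : EuclideanSpace ℝ (Fin n) → EuclideanSpace ℝ (Fin n))
    (x : EuclideanSpace ℝ (Fin n)) :
    (gradMatrix f x).transpose.toEuclideanLin = (fderiv ℝ f x).toLinearMap := by
  refine (EuclideanSpace.basisFun (Fin n) ℝ).toBasis.ext fun j => ?_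
  ext i
  simp [gradMatrix, Matrix.toLpLin_apply]

lemma isPositive_fderiv {f : EuclideanSpace ℝ (Fin n) → EuclideanSpace ℝ (Fin n)}
    {x : EuclideanSpace ℝ (Fin n)} (h : (gradMatrix f x).PosSemidef) :
    (fderiv ℝ f x).IsPositive := by
  rw [← ContinuousLinearMap.isPositive_toLinearMap_iff, ← gradMatrix_eq_fderiv_apply,
    Matrix.isPositive_toEuclideanLin_iff]
  exact h.transpose

lemma divergence_eq_basisTrace (f : EuclideanSpace ℝ (Fin n) → EuclideanSpace ℝ (Fin n))
    (x : EuclideanSpace ℝ (Fin n)) :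
    divergence f x = basisTrace (EuclideanSpace.basisFun (Fin n) ℝ) (fderiv ℝ f x) := by
  simp [divergence, gradMatrix, basisTrace, Matrix.trace, EuclideanSpace.inner_single_right]

/-- Gives measurability of the event that the derivative is positive, needed to move the almost sure
hypothesis from `P` to the law of the noise. -/
lemma isClosed_isPositive {E : Type*} [NormedAddCommGroup E] [InnerProductSpace ℝ E]
    [CompleteSpace E] : IsClosed {A : E →L[ℝ] E | A.IsPositive} := by
  have : {A : E →L[ℝ] E | A.IsPositive} =
      (⋂ u, ⋂ v, {A | ⟪A u, v⟫ = ⟪u, A v⟫}) ∩ ⋂ u, {A | 0 ≤ ⟪A u, u⟫} := by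
    ext A
    simp only [Set.mem_inter_iff, Set.mem_iInter]
    exact ⟨fun h => ⟨fun u v => h.isSymmetric u v, fun u => h.inner_nonneg_left u⟩,
      fun h => ⟨fun u v => h.1 u v, fun u => h.2 u⟩⟩
  rw [this]
  refine IsClosed.inter ?_ ?_
  · exact isClosed_iInter fun u => isClosed_iInter fun v =>
      isClosed_eq (by fun_prop) (by fun_prop)
  · exact isClosed_iInter fun u => isClosed_le continuous_const (by fun_prop)

lemma multivariateGaussian_smul_one {σ : ℝ} (hσ : 0 < σ) :
    multivariateGaussian 0 (σ ^ 2 • (1 : Matrix (Fin n) (Fin n) ℝ)) =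
      (stdGaussian (EuclideanSpace ℝ (Fin n))).map fun x => σ • x := by
  open scoped MatrixOrder in
  have : CFC.sqrt (σ ^ 2 • (1 : Matrix (Fin n) (Fin n) ℝ)) = σ • 1 := by
    refine CFC.sqrt_unique (by simp [sq, smul_smul]) ?_
    rw [Matrix.nonneg_iff_posSemidef]
    exact Matrix.PosSemidef.one.smul hσ.le
  rw [multivariateGaussian, this]
  congr 1
  ext x : 1
  simp

lemma hasLaw_inv_smul {σ : ℝ} (hσ : 0 < σ) {Ω : Type*} [MeasurableSpace Ω] {P : Measure Ω}
    {ε : Ω → EuclideanSpace ℝ (Fin n)}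
    (hε : HasLaw ε (multivariateGaussian 0 (σ ^ 2 • (1 : Matrix (Fin n) (Fin n) ℝ))) P) :
    HasLaw (fun ω => σ⁻¹ • ε ω) (stdGaussian (EuclideanSpace ℝ (Fin n))) P := by
  refine HasLaw.fun_comp (Y := fun x => σ⁻¹ • x) ⟨by fun_prop, ?_⟩ hε
  rw [multivariateGaussian_smul_one hσ, Measure.map_map (by fun_prop) (by fun_prop)]
  have : ((fun x : EuclideanSpace ℝ (Fin n) => σ⁻¹ • x) ∘ fun x => σ • x) = id := by
    ext x : 1
    simp [smul_smul, hσ.ne']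
  rw [this, Measure.map_id]

/-- The estimator in the coordinates where the noise is standard and the mean is zero. -/
noncomputable def standardize (σ : ℝ) (μ : EuclideanSpace ℝ (Fin n))
    (f : EuclideanSpace ℝ (Fin n) → EuclideanSpace ℝ (Fin n)) (x : EuclideanSpace ℝ (Fin n)) :
    EuclideanSpace ℝ (Fin n) := σ⁻¹ • (f (μ + σ • x) - μ)

variable {σ : ℝ} {μ : EuclideanSpace ℝ (Fin n)}
  {f : EuclideanSpace ℝ (Fin n) → EuclideanSpace ℝ (Fin n)}

lemma lipschitzWith_standardize (hσ : 0 < σ) (hf : LipschitzWith 1 f) :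
    LipschitzWith 1 (standardize σ μ f) := by
  refine LipschitzWith.of_dist_le_mul fun x y => ?_
  have h := hf.dist_le_mul (μ + σ • x) (μ + σ • y)
  rw [dist_add_left, dist_smul₀, NNReal.coe_one, one_mul, Real.norm_of_nonneg hσ.le] at h
  rw [standardize, standardize, dist_smul₀, dist_sub_right, NNReal.coe_one, one_mul, norm_inv,
    Real.norm_of_nonneg hσ.le, inv_mul_le_iff₀ hσ]
  exact h

/-- The factors `σ⁻¹` outside and `σ` inside cancel, so trace and positivity carry over unchanged.
-/
lemma fderiv_standardize (hσ : 0 < σ) (x : EuclideanSpace ℝ (Fin n)) :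
    fderiv ℝ (standardize σ μ f) x = fderiv ℝ f (μ + σ • x) := by
  have h1 : standardize σ μ f = σ⁻¹ • fun x => (fun y => f (μ + y)) (σ • x) - μ := rfl
  rw [h1, fderiv_const_smul_field, Pi.smul_apply, fderiv_sub_const,
    fderiv_comp_smul (f := fun y => f (μ + y)), fderiv_comp_add_left, smul_smul, inv_mul_cancel₀ hσ.ne', one_smul]

end Transfer

/-! ### Assembly of the theorem. -/

theorem mainTheorem8 {n : ℕ} (hn : 1 ≤ n) {σ : ℝ} (hσ : 0 < σ)
    {Ω : Type*} [MeasurableSpace Ω] (P : Measure Ω) [IsProbabilityMeasure P]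
    (μ : EuclideanSpace ℝ (Fin n)) (ε y : Ω → EuclideanSpace ℝ (Fin n))
    (hε : HasLaw ε (multivariateGaussian 0 (σ ^ 2 • (1 : Matrix (Fin n) (Fin n) ℝ))) P)
    (hy : ∀ ω, y ω = μ + ε ω)
    (μhat : EuclideanSpace ℝ (Fin n) → EuclideanSpace ℝ (Fin n))
    (hLip : LipschitzWith 1 μhat)
    (hgrad : ∀ᵐ ω ∂P, (gradMatrix μhat (y ω)).PosSemidef) :
    -- the expectations and the variance below are well defined
    Integrable (fun ω => ‖μ - μhat (y ω)‖ ^ 2) P ∧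
    Integrable (fun ω => sure σ μhat (y ω)) P ∧
    Integrable (fun ω => divergence μhat (y ω)) P ∧
    MemLp (fun ω => sure σ μhat (y ω) - ∫ ω', ‖μ - μhat (y ω')‖ ^ 2 ∂P
      + (n * σ ^ 2 - ‖ε ω‖ ^ 2)) 2 P ∧
    -- the variance bound
    Var[fun ω => sure σ μhat (y ω) - ∫ ω', ‖μ - μhat (y ω')‖ ^ 2 ∂P
      + (n * σ ^ 2 - ‖ε ω‖ ^ 2); P]
        ≤ 4 * ∫ ω, (σ ^ 2 * sure σ μhat (y ω) + σ ^ 4 * divergence μhat (y ω)) ∂P ∧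
    -- the data-driven bound, centred at the risk
    (∃ X Y : Ω → ℝ, Measurable X ∧ Measurable Y ∧ (∀ ω, 0 ≤ X ω) ∧ (∀ ω, 0 ≤ Y ω) ∧
      ∫ ω, X ω ^ 2 ∂P = 1 ∧ ∫ ω, Y ω ^ 2 ∂P = 1 ∧
      ∀ᵐ ω ∂P,
        |sure σ μhat (y ω) - ∫ ω', ‖μ - μhat (y ω')‖ ^ 2 ∂P + (n * σ ^ 2 - ‖ε ω‖ ^ 2)|
            / (σ ^ 2 * √n)
          ≤ X ω * (√(gammaHat σ μhat (y ω)) + 4 * Y ω / √n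
              + √(4 * Y ω) * (6 / n) ^ (1 / 4 : ℝ))) ∧
    -- the data-driven bound, centred at the loss
    (∃ X Y : Ω → ℝ, Measurable X ∧ Measurable Y ∧ (∀ ω, 0 ≤ X ω) ∧ (∀ ω, 0 ≤ Y ω) ∧
      ∫ ω, X ω ^ 2 ∂P = 1 ∧ ∫ ω, Y ω ^ 2 ∂P = 1 ∧
      ∀ᵐ ω ∂P,
        |sure σ μhat (y ω) - ‖μ - μhat (y ω)‖ ^ 2 + (n * σ ^ 2 - ‖ε ω‖ ^ 2)|
            / (σ ^ 2 * √n)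
          ≤ X ω * (√(gammaHat σ μhat (y ω)) + 4 * Y ω / √n
              + √(4 * Y ω) * (6 / n) ^ (1 / 4 : ℝ))) ∧
    -- the critical value is well defined, and the two confidence intervals
    (∀ α : ℝ, 0 < α → α < 1 → ∃! v : ℝ, IsChiSquareCritical n α v) ∧
    ∀ α β₁ β₂ δ v : ℝ, 0 < α → 0 < β₁ → 0 < β₂ → α + β₁ + β₂ = δ → δ < 1 →
      IsChiSquareCritical n α v →
      1 - δ ≤ P.real {ω |
        |sure σ μhat (y ω) - ∫ ω', ‖μ - μhat (y ω')‖ ^ 2 ∂P| / (σ ^ 2 * √(2 * n))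
          ≤ v + (√(gammaHat σ μhat (y ω)) + kappa n β₂) / √(2 * β₁)} ∧
      1 - δ ≤ P.real {ω |
        |sure σ μhat (y ω) - ‖μ - μhat (y ω)‖ ^ 2| / (σ ^ 2 * √(2 * n))
          ≤ v + (√(gammaHat σ μhat (y ω)) + kappa n β₂) / √(2 * β₁)} := by
  have hn0 : 0 < n := hn
  have hn' : (0 : ℝ) < n := Nat.cast_pos.2 hn0
  set b := EuclideanSpace.basisFun (Fin n) ℝ
  set g := standardize σ μ μhat with hgdef
  have hg : LipschitzWith 1 g := lipschitzWith_standardize hσ hLip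
  set z : Ω → EuclideanSpace ℝ (Fin n) := fun ω => σ⁻¹ • ε ω with hz
  have hzL : HasLaw z (stdGaussian (EuclideanSpace ℝ (Fin n))) P := hasLaw_inv_smul hσ hε
  have hεz : ∀ ω, ε ω = σ • z ω := fun ω => by simp [hz, smul_smul, hσ.ne']
  have hyz : ∀ ω, y ω = μ + σ • z ω := fun ω => by rw [hy, hεz]
  have hder : ∀ ω, fderiv ℝ g (z ω) = fderiv ℝ μhat (y ω) := fun ω => by
    rw [hgdef, fderiv_standardize hσ, hyz]
  have hpos : ∀ᵐ x ∂(stdGaussian (EuclideanSpace ℝ (Fin n))), (fderiv ℝ g x).IsPositive := by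
    have hm : MeasurableSet {x | (fderiv ℝ g x).IsPositive} :=
      isClosed_isPositive.measurableSet.preimage (measurable_fderiv ℝ g)
    rw [← hzL.map_eq, ae_map_iff hzL.aemeasurable hm]
    filter_upwards [hgrad] with ω hω
    rw [hder]
    exact isPositive_fderiv hω
  have hdiv : ∀ ω, divergence μhat (y ω) = basisTrace b (fderiv ℝ g (z ω)) := fun ω => by
    rw [divergence_eq_basisTrace, hder]
  have hgz : ∀ ω, μhat (y ω) - μ = σ • g (z ω) := fun ω => by
    rw [hgdef, standardize, smul_smul, mul_inv_cancel₀ hσ.ne', one_smul, hyz]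
  have hloss : ∀ ω, ‖μ - μhat (y ω)‖ ^ 2 = σ ^ 2 * ‖g (z ω)‖ ^ 2 := fun ω => by
    rw [norm_sub_rev, hgz, norm_smul, mul_pow, Real.norm_eq_abs, sq_abs]
  have hnoise : ∀ ω, ‖ε ω‖ ^ 2 = σ ^ 2 * ‖z ω‖ ^ 2 := fun ω => by
    rw [hεz, norm_smul, mul_pow, Real.norm_eq_abs, sq_abs]
  have hsure : ∀ ω, sure σ μhat (y ω) = σ ^ 2 * stdSure b g (z ω) := fun ω => by
    have h1 : y ω - μhat (y ω) = σ • (z ω - g (z ω)) := by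
      rw [smul_sub, ← hgz, ← hεz, hy]; abel
    rw [sure, h1, norm_smul, mul_pow, Real.norm_eq_abs, sq_abs, hdiv, stdSure, Fintype.card_fin]
    ring
  have hgam : ∀ ω, gammaHat σ μhat (y ω) =
      4 * max ((stdSure b g (z ω) + basisTrace b (fderiv ℝ g (z ω))) / n) 0 := fun ω => by
    have : (gradMatrix μhat (y ω)).trace = basisTrace b (fderiv ℝ g (z ω)) := hdiv ω
    rw [gammaHat, hsure, this, add_div]
    congr 3
    field_simp
  have hint : ∀ {h : EuclideanSpace ℝ (Fin n) → ℝ}, MemLp h 2 (stdGaussian _) →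
      ∫ ω, h (z ω) ∂P = ∫ x, h x ∂(stdGaussian _) := fun hh =>
    hzL.integral_comp hh.aestronglyMeasurable
  have hmem : ∀ {h : EuclideanSpace ℝ (Fin n) → ℝ}, MemLp h 2 (stdGaussian _) →
      MemLp (fun ω => h (z ω)) 2 P := fun hh => by
    rw [← hzL.map_eq] at hh
    exact hh.comp_of_map hzL.aemeasurable
  have hint2 : ∀ {h : EuclideanSpace ℝ (Fin n) → ℝ}, MemLp h 2 (stdGaussian _) →
      ∫ ω, h (z ω) ^ 2 ∂P = ∫ x, h x ^ 2 ∂(stdGaussian _) := fun {h} hh =>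
    hzL.integral_comp (f := fun x => h x ^ 2) (hh.aestronglyMeasurable.pow 2)
  set m := ∫ x, ‖g x‖ ^ 2 ∂(stdGaussian (EuclideanSpace ℝ (Fin n))) with hm
  have hrisk : ∫ ω', ‖μ - μhat (y ω')‖ ^ 2 ∂P = σ ^ 2 * m := by
    simp only [hloss]
    rw [integral_const_mul, hint (memLp_norm_sq hg)]
  have mD := memLp_basisTrace_fderiv b hg
  have mS := memLp_stdSure (b := b) hg
  have mR := memLp_risk (b := b) hg m
  have mL := memLp_loss (b := b) hg
  have mT : MemLp (fun x => stdSure b g x + basisTrace b (fderiv ℝ g x)) 2 (stdGaussian _) :=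
    mS.add mD
  have bR := integral_stdSure_sub_risk_sq_le (b := b) hg hpos
  have bL := integral_stdSure_sub_loss_sq_le (b := b) hg hpos
  have bT := sqrt_variance_stdSure_add_trace_le (b := b) hg hpos (by simpa using hn0)
  rw [← hm, ← hint2 mR, ← hint mT] at bR
  rw [← hint2 mL, ← hint mT] at bL
  have mT' : MemLp (fun x => stdSure b g x + basisTrace b (fderiv ℝ g x) -
      ∫ z, (stdSure b g z + basisTrace b (fderiv ℝ g z)) ∂(stdGaussian _)) 2 (stdGaussian _) :=
    mT.sub (memLp_const _)
  rw [← hint2 mT', ← hint mT] at bT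
  simp only [Fintype.card_fin] at mR mL bR bL bT
  have eR : ∀ ω, sure σ μhat (y ω) - ∫ ω', ‖μ - μhat (y ω')‖ ^ 2 ∂P + (n * σ ^ 2 - ‖ε ω‖ ^ 2) =
      σ ^ 2 * (stdSure b g (z ω) - m + (n - ‖z ω‖ ^ 2)) := fun ω => by
    rw [hrisk, hsure, hnoise]; ring
  have eL : ∀ ω, sure σ μhat (y ω) - ‖μ - μhat (y ω)‖ ^ 2 + (n * σ ^ 2 - ‖ε ω‖ ^ 2) =
      σ ^ 2 * (stdSure b g (z ω) - ‖g (z ω)‖ ^ 2 + (n - ‖z ω‖ ^ 2)) := fun ω => by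
    rw [hloss, hsure, hnoise]; ring
  have habs : ∀ a s : ℝ, |σ ^ 2 * a| / (σ ^ 2 * s) = |a| / s := fun a s => by
    rw [abs_mul, abs_of_pos (by positivity : 0 < σ ^ 2), mul_div_mul_left _ _ (by positivity)]
  obtain ⟨X, Y, hXm, hYm, hX0, hY0, hX1, hY1, hXY⟩ :=
    exists_data_driven_bound hn' (hmem mT) (hmem mR) bR bT
  obtain ⟨X', Y', hXm', hYm', hX0', hY0', hX1', hY1', hXY'⟩ :=
    exists_data_driven_bound hn' (hmem mT) (hmem mL) bL bT
  refine ⟨?_, ?_, ?_, ?_, ?_, ⟨X, Y, hXm, hYm, hX0, hY0, hX1, hY1, ?_⟩,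
    ⟨X', Y', hXm', hYm', hX0', hY0', hX1', hY1', ?_⟩,
    fun α h0 h1 => existsUnique_isChiSquareCritical hn h0 h1, ?_⟩
  · simp only [hloss]
    exact ((hmem (memLp_norm_sq hg)).integrable (by norm_num)).const_mul _
  · simp only [hsure]
    exact ((hmem mS).integrable (by norm_num)).const_mul _
  · simp only [hdiv]
    exact (hmem mD).integrable (by norm_num)
  · simp only [eR]
    exact (hmem mR).const_mul _
  · simp only [eR]
    simp only [hsure, hdiv]
    rw [variance_const_mul]
    -- The uncentred second moment already satisfies the bound.
    have hv := variance_le_expectation_sq (μ := P) (hmem mR).aestronglyMeasurable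
    have e1 : ∫ ω, (σ ^ 2 * (σ ^ 2 * stdSure b g (z ω)) +
        σ ^ 4 * basisTrace b (fderiv ℝ g (z ω))) ∂P =
        σ ^ 4 * ∫ ω, (stdSure b g (z ω) + basisTrace b (fderiv ℝ g (z ω))) ∂P := by
      rw [← integral_const_mul]
      exact integral_congr_ae (ae_of_all _ fun ω => by ring)
    rw [e1]
    calc _ ≤ (σ ^ 2) ^ 2 * (4 * ∫ ω, (stdSure b g (z ω) + basisTrace b (fderiv ℝ g (z ω))) ∂P) :=
          mul_le_mul_of_nonneg_left (hv.trans bR) (by positivity)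
      _ = _ := by ring
  · simp only [eR, habs, hgam]
    exact hXY
  · simp only [eL, habs, hgam]
    exact hXY'
  · intro α β₁ β₂ δ v hα hβ₁ hβ₂ hδ hδ1 hv
    have hQ : P.real {ω | v < |(‖z ω‖ ^ 2 - n : ℝ)| / √(2 * n)} ≤ α := by
      rw [IsChiSquareCritical, chiSquare_real_eq_chiTail] at hv
      rw [← hv]
      exact (hzL.measureReal_eq (measurableSet_tail v)).le
    -- Separates the controlled variable from the pure noise deviation, whose tail is exactly
    -- chi-square.
    have tri : ∀ a c q : ℝ, |a - c| ≤ |a - c + (n - q)| + |q - n| := fun a c q => by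
      have := abs_add_le (a - c + (n - q)) (q - n)
      rwa [show a - c + (n - q) + (q - n) = a - c by ring] at this
    simp only [hrisk]
    simp only [hloss, hsure, hgam, ← mul_sub, habs]
    exact ⟨le_measureReal_of_data_driven_bound hn0 hY0 hX1 hY1 (fun _ => Real.sqrt_nonneg _) hXY
        (fun ω => tri _ _ _) hβ₁ hβ₂ hδ hQ,
      le_measureReal_of_data_driven_bound hn0 hY0' hX1' hY1' (fun _ => Real.sqrt_nonneg _) hXY'
        (fun ω => tri _ _ _) hβ₁ hβ₂ hδ hQ⟩
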